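/- Let $L$ be an oriented link and let $p$ be a prime or $0$. For a field $\mathbb F$ of characteristic $p$ and an oriented diagram $D$ of $L$ in the plane, with $n_+$ positive and $n_-$ negative crossings, let $C_{\mathrm{BN}}(D;\mathbb F)$ be the Bar-Natan complex, i.e. the Khovanov cube-of-smoothings complex for the Frobenius algebra $A=\mathbb F[X]/(X^2-X)$ with $\Delta(1)=X\otimes 1+1\otimes X-1\otimes 1$, $\varepsilon(1)=0$, $\varepsilon(X)=1$. A smoothing with $r$ $1$-smoothings contributes $A^{\otimes\#\text{circles}}$ in homological degree $r-n_-$; the $q$-degree is determined by $|1|_q=1$, $|X|_q=-1$ on $A$ and a shift by $r+n_+-2n_-$. The subcomplexes $\mathscr F_j$ spanned by the generators of $q$-degree at least $j$, with $j\in|L|+2\mathbb Z$, where $|L|$ is the number of components of $L$, form a finite filtration $\cdots\subset\mathscr F_{j+2}\subset\mathscr F_j\subset\cdots$ of $C_{\mathrm{BN}}(D;\mathbb F)$; let $(E_r^{i,j})$ be the spectral sequence of this filtration (the Bar-Natan--Lee--Turner spectral sequence), where $i$ is the homological degree. Put $$s^p_{\min}(L)=\min\{j\in |L|+2\mathbb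 Z\mid E_\infty^{0,j}\neq 0\}+1 .$$ Let $\mathfrak s_{\mathcal O}\in H^0_{\mathrm{BN}}(L;\mathbb F)$ be the canonical class of the orientation $\mathcal O$ of $L$: color the regions of the plane in checkerboard fashion with the unbounded region white; the class is represented, in the summand of the oriented smoothing of $D$, by $\bigotimes_C I_C$ over the circles $C$ of that smoothing, where $I_C=X$ if the white region is to the right of $C$ and $I_C=1-X$ if it is to the left. Put $$s^p(L)=\max\{j\in|L|+2\mathbb Z\mid \mathfrak s_{\mathcal O}\in\operatorname{im}(H(\mathscr F_j)\to H_{\mathrm{BN}}(L;\mathbb F))\}+1 .$$ Then there is an orientation on the underlying unoriented link of $L$ such that the resulting oriented link $\tilde L$ satisfies $s^p(\tilde L)=s^p_{\min}(L)$, where the common value and the orientation do not depend on the choice of the field $\mathbb F$ of characteristic $p$. Moreover, $\tilde L$ and $L$ have the same total linking number (the sum of the linking numbers of all pairs of distinct components). -/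

import Mathlib

/-- The shape of the nontrivial part of a horizontal slice of a link diagram: a local minimum, a
local maximum, or a crossing.  In `cross b` the strand from bottom left to top right is the
over-strand if and only if `b = true`. -/
inductive SliceKind where
  | cup
  | cap
  | cross (b : Bool)

namespace SliceKind

def isCross : SliceKind → Bool
  | cross _ => true
  | _ => false

def blOver : SliceKind → Bool
  | cross b => b
  | _ => false

/-- `κ.Fits i w w'`: a slice of kind `κ` whose nontrivial part has exactly `i` vertical strands to
its left can have `w` endpoints at its bottom and `w'` endpoints at its top. -/
def Fits : SliceKind → ℕ → ℕ → ℕ → Prop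
  | cup, i, w, w' => i ≤ w ∧ w' = w + 2
  | cap, i, w, w' => i + 2 ≤ w ∧ w = w' + 2
  | cross _, i, w, w' => i + 2 ≤ w ∧ w' = w

end SliceKind

/-- An (unoriented) link diagram in the plane, in general position with respect to the height
function and cut by horizontal lines into slices, listed from bottom to top, each of which consists
of vertical strands and exactly one local minimum, local maximum or crossing. Every link diagram in
the plane is of this form after a planar isotopy. Horizontal line number `k` (for
`k = 0, …, numSlices`) meets the diagram in `width k` points, numbered `0, 1, …` from left to right;
slice number `k` lies between the lines `k` and `k + 1`. -/
structure LinkDiagram where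
  numSlices : ℕ
  kind : Fin numSlices → SliceKind
  pos : Fin numSlices → ℕ
  width : Fin (numSlices + 1) → ℕ
  width_zero : width 0 = 0
  width_last : width (Fin.last numSlices) = 0
  fits : ∀ k, (kind k).Fits (pos k) (width k.castSucc) (width k.succ)

/-- The ways to join the four endpoints of a crossing: straight through the crossing, or by one of
the two smoothings `)(` (vertical) and `≍` (horizontal). -/
inductive CrossingMode where
  | through
  | vertical
  | horizontal

namespace LinkDiagram

/-- The points in which the diagram meets the horizontal lines. -/
abbrev Point (D : LinkDiagram) : Type := (k : Fin (D.numSlices + 1)) × Fin (D.width k)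

abbrev Crossing (D : LinkDiagram) : Type := {k : Fin D.numSlices // (D.kind k).isCross = true}

variable (D : LinkDiagram)

/-- `p` is the `j`-th point on the `k`-th horizontal line. -/
def At (p : D.Point) (k j : ℕ) : Prop := (p.1 : ℕ) = k ∧ (p.2 : ℕ) = j

/-- `D.Arc m p q`: some slice contains an arc from `p` to `q`, when the crossings are treated as
prescribed by `m`. -/
inductive Arc (m : D.Crossing → CrossingMode) : D.Point → D.Point → Prop
  | left (k : Fin D.numSlices) (j : ℕ) (p q : D.Point) :
      j < D.pos k → D.At p k j → D.At q (k + 1) j → Arc m p q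
  | right_of_cup (k : Fin D.numSlices) (j : ℕ) (p q : D.Point) :
      D.kind k = SliceKind.cup → D.pos k ≤ j → D.At p k j → D.At q (k + 1) (j + 2) → Arc m p q
  | right_of_cap (k : Fin D.numSlices) (j : ℕ) (p q : D.Point) :
      D.kind k = SliceKind.cap → D.pos k ≤ j → D.At p k (j + 2) → D.At q (k + 1) j → Arc m p q
  | right_of_cross (c : D.Crossing) (j : ℕ) (p q : D.Point) :
      D.pos c.1 + 2 ≤ j → D.At p c.1 j → D.At q (c.1 + 1) j → Arc m p q
  | cup (k : Fin D.numSlices) (p q : D.Point) : D.kind k = SliceKind.cup →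
      D.At p (k + 1) (D.pos k) → D.At q (k + 1) (D.pos k + 1) → Arc m p q
  | cap (k : Fin D.numSlices) (p q : D.Point) : D.kind k = SliceKind.cap →
      D.At p k (D.pos k) → D.At q k (D.pos k + 1) → Arc m p q
  | through₁ (c : D.Crossing) (p q : D.Point) : m c = CrossingMode.through →
      D.At p c.1 (D.pos c.1) → D.At q (c.1 + 1) (D.pos c.1 + 1) → Arc m p q
  | through₂ (c : D.Crossing) (p q : D.Point) : m c = CrossingMode.through →
      D.At p c.1 (D.pos c.1 + 1) → D.At q (c.1 + 1) (D.pos c.1) → Arc m p q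
  | vertical₁ (c : D.Crossing) (p q : D.Point) : m c = CrossingMode.vertical →
      D.At p c.1 (D.pos c.1) → D.At q (c.1 + 1) (D.pos c.1) → Arc m p q
  | vertical₂ (c : D.Crossing) (p q : D.Point) : m c = CrossingMode.vertical →
      D.At p c.1 (D.pos c.1 + 1) → D.At q (c.1 + 1) (D.pos c.1 + 1) → Arc m p q
  | horizontal₁ (c : D.Crossing) (p q : D.Point) : m c = CrossingMode.horizontal →
      D.At p c.1 (D.pos c.1) → D.At q c.1 (D.pos c.1 + 1) → Arc m p q
  | horizontal₂ (c : D.Crossing) (p q : D.Point) : m c = CrossingMode.horizontal →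
      D.At p (c.1 + 1) (D.pos c.1) → D.At q (c.1 + 1) (D.pos c.1 + 1) → Arc m p q

/-- Two points are equivalent if they lie on the same closed curve. -/
def curveSetoid (m : D.Crossing → CrossingMode) : Setoid D.Point := Relation.EqvGen.setoid (D.Arc m)

/-- The closed curves that arise when the crossings are treated as prescribed by `m`. -/
abbrev Curve (m : D.Crossing → CrossingMode) : Type := Quotient (D.curveSetoid m)

/-- The components of the link. -/
abbrev Component : Type := D.Curve (fun _ => CrossingMode.through)

noncomputable def numComponents : ℕ := Nat.card D.Component

variable {D}

/-- The bottom left endpoint of a crossing. -/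
def bl (c : D.Crossing) : D.Point := ⟨c.1.castSucc, ⟨D.pos c.1, by
  obtain ⟨k, hk⟩ := c
  have h := D.fits k
  cases hx : D.kind k <;> rw [hx] at h hk <;> simp [SliceKind.isCross, SliceKind.Fits] at h hk ⊢
  omega⟩⟩

/-- The bottom right endpoint of a crossing. -/
def br (c : D.Crossing) : D.Point := ⟨c.1.castSucc, ⟨D.pos c.1 + 1, by
  obtain ⟨k, hk⟩ := c
  have h := D.fits k
  cases hx : D.kind k <;> rw [hx] at h hk <;> simp [SliceKind.isCross, SliceKind.Fits] at h hk ⊢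
  omega⟩⟩

/-- The top right endpoint of a crossing. -/
def tr (c : D.Crossing) : D.Point := ⟨c.1.succ, ⟨D.pos c.1 + 1, by
  obtain ⟨k, hk⟩ := c
  have h := D.fits k
  cases hx : D.kind k <;> rw [hx] at h hk <;> simp [SliceKind.isCross, SliceKind.Fits] at h hk ⊢
  omega⟩⟩

variable (D)

/-- An orientation of the link, given by the vertical direction (`true` for upwards) in which each
point is passed: it is kept along arcs between different lines, and it changes along the arc of a
local maximum or minimum. -/
structure Orientation where
  up : D.Point → Bool
  compat : ∀ p q, D.Arc (fun _ => CrossingMode.through) p q → (up p = up q ↔ p.1 ≠ q.1)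

variable {D}

/-- A crossing is positive if turning the over-strand counterclockwise through the angle smaller
than `π` moves its direction to that of the under-strand. -/
def IsPositive (o : D.Orientation) (c : D.Crossing) : Bool :=
  (D.kind c.1).blOver == (o.up (bl c) == o.up (br c))

def nPlus (o : D.Orientation) : ℕ :=
  (Finset.univ.filter fun c : D.Crossing => IsPositive o c = true).card

def nMinus (o : D.Orientation) : ℕ :=
  (Finset.univ.filter fun c : D.Crossing => IsPositive o c = false).card

open Classical in
/-- The sum of the linking numbers of all unordered pairs of distinct components, i.e. half the
number of crossings between distinct components, counted with sign. -/
noncomputable def totalLinkingNumber (o : D.Orientation) : ℚ :=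
  (∑ c : D.Crossing,
    if (⟦bl c⟧ : D.Component) = ⟦br c⟧ then 0 else if IsPositive o c = true then 1 else -1) / 2

variable (D)

/-- A choice of a `0`-smoothing (`false`) or a `1`-smoothing (`true`) at each crossing. -/
abbrev State : Type := D.Crossing → Bool

variable {D}

/-- Turning the over-strand counterclockwise sweeps the two regions that are joined in the
`0`-smoothing. -/
def smoothing (v : D.State) (c : D.Crossing) : CrossingMode :=
  if (D.kind c.1).blOver = v c then CrossingMode.horizontal else CrossingMode.vertical

abbrev Circle (v : D.State) : Type := D.Curve (smoothing v)

variable (D)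

/-- A basis of `⨁_v A^{⊗ circles of v}`, where `A = F[X]/(X² - X)` has the basis `1, X`: a state
together with a label `1` (`false`) or `X` (`true`) on each of its circles. -/
abbrev EnhancedState : Type := (v : D.State) × (Circle v → Bool)

noncomputable instance instFintypeEnhancedState : Fintype D.EnhancedState := by
  classical
  haveI (v : D.State) : Finite (Circle v) := Quotient.finite _
  haveI (v : D.State) : Fintype (Circle v) := Fintype.ofFinite _
  exact inferInstance

variable {D}

/-- The coefficient of the basis element `z` in the product `x y` in `F[X]/(X² - X)`. -/
def mulCoeff (x y z : Bool) : ℤ := if z = (x || y) then 1 else 0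

/-- The coefficient of `y ⊗ z` in `Δ x`, where
`Δ 1 = X ⊗ 1 + 1 ⊗ X - 1 ⊗ 1` and `Δ X = X ⊗ X`. -/
def comulCoeff (x y z : Bool) : ℤ :=
  match x, y, z with
  | false, true, false => 1
  | false, false, true => 1
  | false, false, false => -1
  | true, true, true => 1
  | _, _, _ => 0

open Classical in
/-- The matrix coefficient from `s` to `t` of the map induced by the saddle at `c`. The two arcs of
either smoothing of `c` contain `bl c` and `tr c`, respectively; hence the saddle merges two circles
if these points lie on distinct circles before the saddle, and it splits a circle if they lie on
distinct circles only afterwards. -/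
noncomputable def saddleCoeff (c : D.Crossing) (s t : D.EnhancedState) : ℤ :=
  if ∀ p : D.Point, (⟦p⟧ : Circle s.1) ≠ ⟦bl c⟧ → (⟦p⟧ : Circle s.1) ≠ ⟦tr c⟧ →
      s.2 ⟦p⟧ = t.2 ⟦p⟧ then
    if (⟦bl c⟧ : Circle s.1) ≠ ⟦tr c⟧ then mulCoeff (s.2 ⟦bl c⟧) (s.2 ⟦tr c⟧) (t.2 ⟦bl c⟧)
    else if (⟦bl c⟧ : Circle t.1) ≠ ⟦tr c⟧ then
      comulCoeff (s.2 ⟦bl c⟧) (t.2 ⟦bl c⟧) (t.2 ⟦tr c⟧)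
    else 0
  else 0

open Classical in
/-- The matrix coefficient from `s` to `t` of the differential of the cube of smoothings. -/
noncomputable def dCoeff (s t : D.EnhancedState) : ℤ :=
  ∑ c : D.Crossing,
    if s.1 c = false ∧ t.1 = Function.update s.1 c true then
      (-1) ^ (Finset.univ.filter fun c' : D.Crossing => c' < c ∧ s.1 c' = true).card *
        saddleCoeff c s t
    else 0

section BarNatan

variable (F : Type*) [Field F]

variable (D) in
/-- The sum of all cochain groups of the Bar-Natan complex of `D`. -/
abbrev Cochain : Type _ := D.EnhancedState → F

/-- The differential of the Bar-Natan complex. -/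
noncomputable def d : D.Cochain F →ₗ[F] D.Cochain F where
  toFun x t := ∑ s, (dCoeff s t : F) * x s
  map_add' x y := by
    funext t
    simp [mul_add, Finset.sum_add_distrib]
  map_smul' a x := by
    funext t
    simp only [Pi.smul_apply, smul_eq_mul, RingHom.id_apply, Finset.mul_sum]
    exact Finset.sum_congr rfl fun s _ => by ring

/-- The number of `1`-smoothings. -/
def weight (v : D.State) : ℕ := (Finset.univ.filter fun c => v c = true).card

/-- The homological degree. -/
def homDegree (o : D.Orientation) (s : D.EnhancedState) : ℤ := weight s.1 - nMinus o

/-- The `q`-degree, where `|1|_q = 1` and `|X|_q = -1`. -/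
noncomputable def qDegree (o : D.Orientation) (s : D.EnhancedState) : ℤ :=
  (∑ᶠ C : Circle s.1, if s.2 C = true then -1 else 1) + weight s.1 + nPlus o - 2 * nMinus o

/-- The cochains of homological degree `i`. -/
def homPart (o : D.Orientation) (i : ℤ) : Submodule F (D.Cochain F) where
  carrier := {x | ∀ s, x s ≠ 0 → homDegree o s = i}
  add_mem' {x y} hx hy s hs := by
    by_cases h : x s = 0
    · exact hy s fun h' => hs (by simp [h, h'])
    · exact hx s h
  zero_mem' s hs := absurd rfl hs
  smul_mem' a x hx s hs := hx s fun h => hs (by simp [h])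

/-- The filtration `𝓕_j`: the cochains that are combinations of generators of `q`-degree at
least `j`. -/
def filtration (o : D.Orientation) (j : ℤ) : Submodule F (D.Cochain F) where
  carrier := {x | ∀ s, x s ≠ 0 → j ≤ qDegree o s}
  add_mem' {x y} hx hy s hs := by
    by_cases h : x s = 0
    · exact hy s fun h' => hs (by simp [h, h'])
    · exact hx s h
  zero_mem' s hs := absurd rfl hs
  smul_mem' a x hx s hs := hx s fun h => hs (by simp [h])

/-! ### Bar-Natan homology and the `s`-invariant -/

variable (D) in
/-- Cochains modulo coboundaries. Homology is the subspace of the classes of cocycles. -/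
abbrev CochainClass : Type _ := D.Cochain F ⧸ LinearMap.range (d F : D.Cochain F →ₗ[F] D.Cochain F)

/-- `im (H(𝓕_j) → H)`: the classes of the cocycles in `𝓕_j`. -/
noncomputable def homologyFiltration (o : D.Orientation) (j : ℤ) : Submodule F (D.CochainClass F) :=
  (LinearMap.ker (d F) ⊓ filtration F o j).map (Submodule.mkQ _)

/-- The smoothing of the diagram that preserves the orientation: `)(` if both strands pass the
crossing upwards or both pass it downwards, and `≍` otherwise. -/
def orientedState (o : D.Orientation) : D.State := fun c =>
  (D.kind c.1).blOver != (o.up (bl c) == o.up (br c))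

/-- Color the regions of the plane such that the region between the points `j - 1` and `j` of a
horizontal line is white if and only if `j` is even; in particular, the unbounded region is white.
Then `whiteOnRight o p` says whether the region to the right of the oriented curve through `p` is
white. -/
def whiteOnRight (o : D.Orientation) (p : D.Point) : Bool :=
  if o.up p = true then decide (Even ((p.2 : ℕ) + 1)) else decide (Even (p.2 : ℕ))

theorem at_unique {p q : D.Point} {k j : ℕ} (hp : D.At p k j) (hq : D.At q k j) : p = q := by
  obtain ⟨p1, p2⟩ := p
  obtain ⟨q1, q2⟩ := q
  obtain ⟨h1, h2⟩ := hp
  obtain ⟨h3, h4⟩ := hq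
  obtain rfl : p1 = q1 := Fin.ext (h1.trans h3.symm)
  obtain rfl : p2 = q2 := Fin.ext (h2.trans h4.symm)
  rfl


theorem whiteOnRight_eq_of_through (o : D.Orientation) {p q : D.Point}
    (h : D.Arc (fun _ => CrossingMode.through) p q)
    (hpq : (p.1 ≠ q.1 ∧ Even ((p.2 : ℕ) + q.2)) ∨ (p.1 = q.1 ∧ ¬ Even ((p.2 : ℕ) + q.2))) :
    whiteOnRight o p = whiteOnRight o q := by
  have hc := o.compat p q h
  unfold whiteOnRight
  rcases hpq with ⟨h1, h2⟩ | ⟨h1, h2⟩ <;> cases hp : o.up p <;> cases hq : o.up q <;>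
    simp_all [Nat.even_add, Nat.even_add_one] <;> rw [← Nat.not_even_iff_odd] <;> tauto

theorem up_bl_eq (o : D.Orientation) (c : D.Crossing) {q : D.Point}
    (hq : D.At q (c.1 + 1) (D.pos c.1 + 1)) : o.up (bl c) = o.up q := by
  refine (o.compat _ _ (Arc.through₁ c _ _ rfl ⟨rfl, rfl⟩ hq)).2 fun h => ?_
  have h' := congrArg Fin.val h
  simp [bl, hq.1] at h'

theorem up_br_eq (o : D.Orientation) (c : D.Crossing) {q : D.Point}
    (hq : D.At q (c.1 + 1) (D.pos c.1)) : o.up (br c) = o.up q := by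
  refine (o.compat _ _ (Arc.through₂ c _ _ rfl ⟨rfl, rfl⟩ hq)).2 fun h => ?_
  have h' := congrArg Fin.val h
  simp [br, hq.1] at h'

theorem smoothing_orientedState (o : D.Orientation) (c : D.Crossing) :
    smoothing (orientedState o) c =
      if o.up (bl c) = o.up (br c) then CrossingMode.vertical else CrossingMode.horizontal := by
  unfold smoothing orientedState
  cases (D.kind c.1).blOver <;> cases o.up (bl c) <;> cases o.up (br c) <;> rfl

theorem whiteOnRight_eq_of_arc (o : D.Orientation) {p q : D.Point}
    (h : D.Arc (smoothing (orientedState o)) p q) : whiteOnRight o p = whiteOnRight o q := by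
  have ne {p q : D.Point} {k : ℕ} (h1 : (p.1 : ℕ) = k) (h2 : (q.1 : ℕ) = k + 1) : p.1 ≠ q.1 :=
    fun h => by have := congrArg Fin.val h; omega
  cases h with
  | left k j p q hj hp hq =>
    exact whiteOnRight_eq_of_through o (.left k j p q hj hp hq)
      (.inl ⟨ne hp.1 hq.1, by rw [hp.2, hq.2]; exact ⟨j, rfl⟩⟩)
  | right_of_cup k j p q hk hj hp hq =>
    exact whiteOnRight_eq_of_through o (.right_of_cup k j p q hk hj hp hq)
      (.inl ⟨ne hp.1 hq.1, by rw [hp.2, hq.2]; exact ⟨j + 1, by ring⟩⟩)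
  | right_of_cap k j p q hk hj hp hq =>
    exact whiteOnRight_eq_of_through o (.right_of_cap k j p q hk hj hp hq)
      (.inl ⟨ne hp.1 hq.1, by rw [hp.2, hq.2]; exact ⟨j + 1, by ring⟩⟩)
  | right_of_cross c j p q hj hp hq =>
    exact whiteOnRight_eq_of_through o (.right_of_cross c j p q hj hp hq)
      (.inl ⟨ne hp.1 hq.1, by rw [hp.2, hq.2]; exact ⟨j, rfl⟩⟩)
  | cup k p q hk hp hq =>
    exact whiteOnRight_eq_of_through o (.cup k p q hk hp hq)
      (.inr ⟨Fin.ext (hp.1.trans hq.1.symm), by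
        rw [hp.2, hq.2]; simp [Nat.even_add_one, ← add_assoc]⟩)
  | cap k p q hk hp hq =>
    exact whiteOnRight_eq_of_through o (.cap k p q hk hp hq)
      (.inr ⟨Fin.ext (hp.1.trans hq.1.symm), by
        rw [hp.2, hq.2]; simp [Nat.even_add_one, ← add_assoc]⟩)
  | through₁ c p q hm => rw [smoothing_orientedState] at hm; split_ifs at hm
  | through₂ c p q hm => rw [smoothing_orientedState] at hm; split_ifs at hm
  | vertical₁ c p q hm hp hq =>
    rw [smoothing_orientedState] at hm
    split_ifs at hm with hu
    have h1 := up_br_eq o c hq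
    obtain rfl : p = bl c := at_unique hp ⟨rfl, rfl⟩
    simp [whiteOnRight, hp.2, hq.2, ← h1, hu]
  | vertical₂ c p q hm hp hq =>
    rw [smoothing_orientedState] at hm
    split_ifs at hm with hu
    have h1 := up_bl_eq o c hq
    obtain rfl : p = br c := at_unique hp ⟨rfl, rfl⟩
    simp [whiteOnRight, hp.2, hq.2, ← h1, hu]
  | horizontal₁ c p q hm hp hq =>
    rw [smoothing_orientedState] at hm
    split_ifs at hm with hu
    obtain rfl : p = bl c := at_unique hp ⟨rfl, rfl⟩
    obtain rfl : q = br c := at_unique hq ⟨rfl, rfl⟩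
    unfold whiteOnRight
    rw [hp.2, hq.2]
    cases h1 : o.up (bl c) <;> cases h2 : o.up (br c) <;> simp_all [Nat.even_add_one]
  | horizontal₂ c p q hm hp hq =>
    rw [smoothing_orientedState] at hm
    split_ifs at hm with hu
    have h1 := up_br_eq o c hp
    have h2 := up_bl_eq o c hq
    unfold whiteOnRight
    rw [hp.2, hq.2, ← h1, ← h2]
    cases h1 : o.up (bl c) <;> cases h2 : o.up (br c) <;> simp_all [Nat.even_add_one]

/-- Whether the region to the right of a circle of the oriented smoothing is white. -/
def circleWhiteOnRight (o : D.Orientation) (v : D.State) (hv : v = orientedState o) :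
    Circle v → Bool :=
  Quotient.lift (whiteOnRight o) fun p q h => by
    subst hv
    induction h with
    | rel _ _ h => exact whiteOnRight_eq_of_arc o h
    | refl _ => rfl
    | symm _ _ _ ih => exact ih.symm
    | trans _ _ _ _ _ ih₁ ih₂ => exact ih₁.trans ih₂

/-- The coefficient of the basis element `x` of `F[X]/(X² - X)` in `X` (if `w = true`) or in
`1 - X` (if `w = false`). -/
def idempotentCoeff (w x : Bool) : ℤ :=
  if x = true then (if w = true then 1 else -1) else (if w = true then 0 else 1)

open Classical in
/-- The canonical cocycle `𝔰_o`: in the summand of the oriented smoothing, it is the tensor product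
over all circles `C` of the elements `I_C`, where `I_C = X` if the white region is to the right of
`C`, and `I_C = 1 - X` if it is to the left. -/
noncomputable def canonicalCocycle (o : D.Orientation) : D.Cochain F := fun s =>
  if h : s.1 = orientedState o then
    ∏ᶠ C : Circle s.1, (idempotentCoeff (circleWhiteOnRight o s.1 h C) (s.2 C) : F)
  else 0

/-- `t` is the `s`-invariant of the oriented link, computed over the field `F`:
`t - 1` is the `q`-grading of the class of the canonical cocycle, i.e. the maximum of all
`j ∈ |L| + 2ℤ` such that the class lies in the `j`-th step of the filtration of homology. -/
def IsSInvariant (o : D.Orientation) (t : ℤ) : Prop :=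
  IsGreatest {j : ℤ | j ≡ D.numComponents [ZMOD 2] ∧
    Submodule.Quotient.mk (canonicalCocycle F o) ∈ homologyFiltration F o j} (t - 1)

/-! ### The spectral sequence -/

/-- `Z_r^{i,j}`: the cochains in `𝓕_j` of homological degree `i` whose coboundary lies
in `𝓕_{j+2r}`. -/
noncomputable def pageCycles (o : D.Orientation) (r i j : ℤ) : Submodule F (D.Cochain F) :=
  homPart F o i ⊓ filtration F o j ⊓ (filtration F o (j + 2 * r)).comap (d F)

/-- `Z_{r-1}^{i,j+2} + d Z_{r-1}^{i-1,j-2(r-1)}`. -/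
noncomputable def pageBoundaries (o : D.Orientation) (r i j : ℤ) : Submodule F (D.Cochain F) :=
  pageCycles F o (r - 1) i (j + 2) ⊔ (pageCycles F o (r - 1) (i - 1) (j - 2 * (r - 1))).map (d F)

/-- The term `E_r^{i,j}`, for `j ∈ |L| + 2ℤ`, of the spectral sequence of the filtered Bar-Natan
complex `⋯ ⊆ 𝓕_{j+2} ⊆ 𝓕_j ⊆ 𝓕_{j-2} ⊆ ⋯`. -/
abbrev Page (o : D.Orientation) (r i j : ℤ) : Type _ :=
  pageCycles F o r i j ⧸ (pageBoundaries F o r i j).comap (pageCycles F o r i j).subtype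

/-- `E_∞^{i,j} ≠ 0`. The filtration is finite, so for fixed `i` and `j` all terms `E_r^{i,j}` with
`r` sufficiently large agree, and they are `E_∞^{i,j}`. -/
def EInftyNeZero (o : D.Orientation) (i j : ℤ) : Prop :=
  ∀ᶠ r : ℤ in Filter.atTop, Nontrivial (Page F o r i j)

/-- `t = s_min`, computed over the field `F`: `t - 1` is the minimum of all `j` with
`E_∞^{0,j} ≠ 0`. -/
def IsSMin (o : D.Orientation) (t : ℤ) : Prop :=
  IsLeast {j : ℤ | j ≡ D.numComponents [ZMOD 2] ∧ EInftyNeZero F o 0 j} (t - 1)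

end BarNatan

end LinkDiagram

/-!
The algebra `F[X]/(X² - X)` has the two characters `X ↦ 0` and `X ↦ 1`, so the characters of the
summand at a smoothing `v` are the labelings `f` of the points that are constant on the circles of
`v`. A saddle at `c` vanishes under `f` unless `f` takes a single value on the endpoints of `c`, in
which case it multiplies the value by a sign. Evaluation thus decomposes the Bar-Natan complex into
the complexes of the cubes spanned by the crossings on which `f` is constant. A cube of positive
dimension is acyclic. If `f` is not constant on any crossing, then only one smoothing is left, and
it is the oriented smoothing of the orientation that is determined by the checkerboard coloring and
`f`. Hence the canonical classes of the orientations form a basis of the homology, and the class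
of `o'` has homological degree `nMinus o' - nMinus o` with respect to `o`.

The filtration step at which `E_∞^{0,*}` first becomes nonzero is therefore the minimum of the
`s`-invariants of the orientations `o'` with `nMinus o' = nMinus o`. The signs of the
self-crossings of a component do not depend on the orientation, so these `o'` have the same total
linking number as `o`. All of this can be computed over the prime field, of which every field of
the given characteristic contains a copy as a linear retract.

That the cubes have anticommuting signs rests on planarity: the circles of a smoothing, oriented by
the checkerboard coloring, are the cycles of a permutation of the points, and a saddle multiplies
this permutation by a transposition. Hence a saddle always merges or splits circles.
-/

section Cycles

open Equiv Equiv.Perm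

variable {α : Type*} [DecidableEq α] [Finite α] {σ : Perm α} {x y : α}

theorem sameCycle_mul_swap_of_not_sameCycle (h : ¬ σ.SameCycle x y) :
    (σ * swap x y).SameCycle x y := by
  have key (n : ℕ) : (σ * swap x y).SameCycle x ((σ ^ (n + 1)) y) := by
    induction n with
    | zero => exact ⟨1, by simp⟩
    | succ n ih =>
      have hx : (σ ^ (n + 1)) y ≠ x := fun hx =>
        h (SameCycle.symm ⟨(n + 1 : ℕ), by rwa [zpow_natCast]⟩)
      rcases eq_or_ne ((σ ^ (n + 1)) y) y with hy | hy
      · exact ⟨1, by rw [pow_succ', mul_apply, hy]; simp⟩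
      · convert sameCycle_apply_right.2 ih using 1
        rw [mul_apply, swap_apply_of_ne_of_ne hx hy, pow_succ', mul_apply]
  have hy : (σ ^ (orderOf σ - 1 + 1)) y = y := by
    rw [Nat.sub_add_cancel (orderOf_pos σ), pow_orderOf_eq_one, one_apply]
  simpa only [hy] using key (orderOf σ - 1)

theorem not_sameCycle_mul_swap_of_sameCycle (hxy : x ≠ y) (h : σ.SameCycle x y) :
    ¬ (σ * swap x y).SameCycle x y := by
  classical
  have hex : ∃ n : ℕ, (σ ^ n) x = y := h.exists_nat_pow_eq
  obtain ⟨n, hn, hmin⟩ : ∃ n : ℕ, (σ ^ n) x = y ∧ ∀ m < n, (σ ^ m) x ≠ y :=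
    ⟨Nat.find hex, Nat.find_spec hex, fun _ => Nat.find_min hex⟩
  have hn0 : 0 < n := Nat.pos_of_ne_zero fun h0 => hxy (by simpa [h0] using hn)
  have hx : ∀ i, 0 < i → i ≤ n → (σ ^ i) x ≠ x := fun i h0 hi he => by
    refine hmin (n - i) (by omega) ?_
    rw [← hn, ← Nat.sub_add_cancel hi, pow_add, mul_apply, he, Nat.add_sub_cancel]
  -- The path from `σ x` to `y` in the cycle of `σ` closes up to a cycle of `σ * swap x y`.
  let path : Set α := {z | ∃ i, 0 < i ∧ i ≤ n ∧ z = (σ ^ i) x}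
  have hpath : Set.MapsTo (σ * swap x y) path path := by
    rintro _ ⟨i, h0, hi, rfl⟩
    rcases hi.eq_or_lt with rfl | hlt
    · exact ⟨1, one_pos, hn0, by simp [hn]⟩
    · refine ⟨i + 1, by omega, hlt, ?_⟩
      rw [mul_apply, swap_apply_of_ne_of_ne (hx i h0 hi) (hmin i hlt), pow_succ', mul_apply]
  intro hs
  obtain ⟨k, hk⟩ := hs.symm.exists_nat_pow_eq
  obtain ⟨i, h0, hi, he⟩ := hpath.perm_pow k ⟨n, hn0, le_rfl, hn.symm⟩
  exact hx i h0 hi (he.symm.trans hk)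

theorem sameCycle_mul_swap_iff (hxy : x ≠ y) :
    (σ * swap x y).SameCycle x y ↔ ¬ σ.SameCycle x y :=
  ⟨mt (not_sameCycle_mul_swap_of_sameCycle hxy) ∘ not_not_intro,
    sameCycle_mul_swap_of_not_sameCycle⟩

end Cycles

theorem card_quotient_eq_add_one {α : Type*} [Finite α] {r r' : Setoid α} {x y : α}
    (hxy : ¬ r x y) (h : ∀ p q, r' p q ↔ r p q ∨ (r p x ∨ r p y) ∧ (r q x ∨ r q y)) :
    Nat.card (Quotient r) = Nat.card (Quotient r') + 1 := by
  classical
  let φ : Quotient r → Quotient r' := Quotient.map id fun p q hpq => (h p q).2 (.inl hpq)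
  have hφ : Function.Bijective fun C : {C : Quotient r // C ≠ ⟦y⟧} => φ C.1 := by
    constructor
    · rintro ⟨⟨p⟩, hp⟩ ⟨⟨q⟩, hq⟩ hpq
      have hp' : ¬ r p y := fun h' => hp (Quotient.sound h')
      have hq' : ¬ r q y := fun h' => hq (Quotient.sound h')
      refine Subtype.ext (Quotient.sound ?_)
      rcases (h p q).1 (Quotient.exact hpq) with hpq | ⟨hpx, hqx⟩
      · exact hpq
      · exact r.trans (hpx.resolve_right hp') (r.symm (hqx.resolve_right hq'))
    · rintro ⟨p⟩
      by_cases hp : r p y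
      · exact ⟨⟨⟦x⟧, fun hx => hxy (Quotient.exact hx)⟩,
          Quotient.sound ((h x p).2 (.inr ⟨.inl (r.refl x), .inr hp⟩))⟩
      · exact ⟨⟨⟦p⟧, fun hp' => hp (Quotient.exact hp')⟩, rfl⟩
  rw [← Nat.card_eq_of_bijective _ hφ, ← Finite.card_option]
  exact Nat.card_congr (Equiv.optionSubtypeNe _).symm

section Cube

open Function Finset

variable {ι R : Type*} [DecidableEq ι] [CommRing R]

/-- The differential of the cochains on the vertices of a cube, with the sign `ε v c` on the edge
that leaves `v` in direction `c`, where only the edges in the directions in `A` are taken into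
account. -/
def cubeDifferential (A : Finset ι) (ε : (ι → Bool) → ι → R) (g : (ι → Bool) → R)
    (w : ι → Bool) : R :=
  ∑ c ∈ A with w c = true, ε (update w c false) c * g (update w c false)

/-- Signs on the edges of a cube that anticommute around each two-dimensional face with directions
in `A` and vertices in `S`. -/
structure IsCubeSign (A : Finset ι) (S : Set (ι → Bool)) (ε : (ι → Bool) → ι → R) : Prop where
  update_mem : ∀ v ∈ S, ∀ c ∈ A, ∀ b, update v c b ∈ S
  mul_self : ∀ v ∈ S, ∀ c ∈ A, v c = false → ε v c * ε v c = 1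
  anticomm : ∀ v ∈ S, ∀ c ∈ A, ∀ c' ∈ A, c ≠ c' → v c = false → v c' = false →
    ε (update v c true) c' * ε v c = -(ε (update v c' true) c * ε v c')

namespace IsCubeSign

variable {A : Finset ι} {S : Set (ι → Bool)} {ε : (ι → Bool) → ι → R} (h : IsCubeSign A S ε)
  {w : ι → Bool}
include h

theorem cubeDifferential_cubeDifferential (hw : w ∈ S) (g : (ι → Bool) → R) :
    cubeDifferential A ε (cubeDifferential A ε g) w = 0 := by
  simp only [cubeDifferential, mul_sum, sum_sigma']
  refine sum_involution (fun e _ => ⟨e.2, e.1⟩) ?_ ?_ ?_ fun _ _ => rfl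
  · rintro ⟨c, c'⟩ he
    simp only [mem_sigma, mem_filter] at he
    obtain ⟨⟨hcA, hc⟩, hcA', hc'⟩ := he
    have hne : c ≠ c' := fun hcc => by simp [hcc] at hc'
    rw [update_of_ne hne.symm] at hc'
    set v := update (update w c false) c' false with hv
    have hvS : v ∈ S := h.update_mem _ (h.update_mem w hw c hcA false) c' hcA' false
    have h₁ : update v c' true = update w c false := by
      rw [hv, update_idem, update_eq_self_iff, update_of_ne hne.symm, hc']
    have h₂ : update v c true = update w c' false := by
      rw [hv, update_comm hne, update_idem, update_eq_self_iff, update_of_ne hne, hc]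
    have h₃ : update (update w c' false) c false = v := update_comm hne.symm _ _ _
    have hanti := h.anticomm v hvS c hcA c' hcA' hne (by simp [v, hne]) (by simp [v])
    rw [h₁, h₂] at hanti
    simp only [h₃]
    linear_combination g v * hanti
  · rintro ⟨c, c'⟩ he _ hcc
    obtain rfl : c' = c := congrArg Sigma.fst hcc
    simp at he
  · rintro ⟨c, c'⟩ he
    simp only [mem_sigma, mem_filter] at he ⊢
    obtain ⟨⟨hcA, hc⟩, hcA', hc'⟩ := he
    have hne : c ≠ c' := fun hcc => by simp [hcc] at hc'
    rw [update_of_ne hne.symm] at hc'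
    exact ⟨⟨hcA', hc'⟩, hcA, by rwa [update_of_ne hne]⟩

theorem mul_add_mul_eq_zero {c c₀ : ι} (hw : w ∈ S) (hcA : c ∈ A) (hcA₀ : c₀ ∈ A)
    (hc : w c = true) (hc₀ : w c₀ = false) :
    ε w c₀ * ε (update (update w c₀ true) c false) c +
      ε (update w c false) c * ε (update w c false) c₀ = 0 := by
  have hne : c ≠ c₀ := fun hcc => by simp [hcc, hc₀] at hc
  have hv := h.update_mem w hw c hcA false
  have hanti := h.anticomm _ hv c hcA c₀ hcA₀ hne (by simp) (by simp [hne.symm, hc₀])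
  rw [update_idem, update_eq_self_iff.2 hc.symm, update_comm hne] at hanti
  have h₁ := h.mul_self _ hv c hcA (by simp)
  have h₂ := h.mul_self _ (h.update_mem _ (h.update_mem w hw c₀ hcA₀ true) c hcA false) c hcA
    (by simp)
  linear_combination ε (update w c false) c * ε (update (update w c₀ true) c false) c * hanti -
    ε (update w c false) c * ε (update w c false) c₀ * h₂ -
    ε w c₀ * ε (update (update w c₀ true) c false) c * h₁

theorem exists_cubeDifferential_eq (hA : A.Nonempty) {g : (ι → Bool) → R}
    (hg : ∀ w ∈ S, cubeDifferential A ε g w = 0) :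
    ∃ g', ∀ w ∈ S, cubeDifferential A ε g' w = g w := by
  obtain ⟨c₀, hc₀⟩ := hA
  refine ⟨fun v => if v c₀ = true then 0 else ε v c₀ * g (update v c₀ true), fun w hw => ?_⟩
  by_cases hw₀ : w c₀ = true
  · have hw' : update w c₀ true = w := by rw [update_eq_self_iff, hw₀]
    rw [cubeDifferential, sum_eq_single_of_mem c₀ (by simp [hc₀, hw₀])]
    · have hsq := h.mul_self _ (h.update_mem w hw c₀ hc₀ false) c₀ hc₀ (by simp)
      simp only [update_self, Bool.false_eq_true, if_false, update_idem, hw']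
      linear_combination g w * hsq
    · intro c _ hc
      simp [update_of_ne hc.symm, hw₀]
  · rw [Bool.not_eq_true] at hw₀
    have hw' : update w c₀ false = w := by rw [update_eq_self_iff, hw₀]
    have hfilter : ({c ∈ A | update w c₀ true c = true} : Finset ι) =
        insert c₀ {c ∈ A | w c = true} := by
      ext c
      rcases eq_or_ne c c₀ with rfl | hc <;> simp [*]
    have hdg := hg _ (h.update_mem w hw c₀ hc₀ true)
    rw [cubeDifferential, hfilter, sum_insert (by simp [hw₀]), update_idem, hw'] at hdg
    have hsq := h.mul_self w hw c₀ hc₀ hw₀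
    suffices hsum : cubeDifferential A ε _ w =
        -(ε w c₀ * ∑ c ∈ A with w c = true, ε (update (update w c₀ true) c false) c *
          g (update (update w c₀ true) c false)) by
      rw [hsum]
      linear_combination g w * hsq - ε w c₀ * hdg
    rw [cubeDifferential, mul_sum, ← sum_neg_distrib]
    refine sum_congr rfl fun c hc => ?_
    obtain ⟨hcA, hc⟩ := mem_filter.1 hc
    have hne : c ≠ c₀ := fun hcc => by simp [hcc, hw₀] at hc
    rw [update_of_ne hne.symm, if_neg (by simp [hw₀]), update_comm hne]
    linear_combination g (update (update w c₀ true) c false) *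
      h.mul_add_mul_eq_zero hw hcA hc₀ hc hw₀

end IsCubeSign

end Cube

namespace LinkDiagram

variable {D : LinkDiagram}

theorem point_ext {p q : D.Point} (h₁ : p.1 = q.1) (h₂ : (p.2 : ℕ) = q.2) : p = q :=
  at_unique ⟨congrArg Fin.val h₁, h₂⟩ ⟨rfl, rfl⟩

/-- Whether slice `k` of the smoothing `v` contains an arc that joins two points of its bottom line
(`s = false`) or of its top line (`s = true`). -/
def turns (v : D.State) (k : Fin D.numSlices) (s : Bool) : Bool :=
  match h : D.kind k with
  | .cup => s
  | .cap => !s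
  | .cross b => b == v ⟨k, by rw [h]; rfl⟩

theorem turns_cup {k : Fin D.numSlices} (hk : D.kind k = .cup) (v : D.State) (s : Bool) :
    turns v k s = s := by
  unfold turns
  split <;> simp_all

theorem turns_cap {k : Fin D.numSlices} (hk : D.kind k = .cap) (v : D.State) (s : Bool) :
    turns v k s = !s := by
  unfold turns
  split <;> simp_all

theorem turns_crossing (v : D.State) (c : D.Crossing) (s : Bool) :
    turns v c.1 s = ((D.kind c.1).blOver == v c) := by
  obtain ⟨k, hk⟩ := c
  unfold turns
  split <;> rename_i h <;> simp only [h] at hk ⊢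
  · cases hk
  · cases hk
  · rfl

theorem smoothing_eq_horizontal_iff {v : D.State} {c : D.Crossing} :
    smoothing v c = .horizontal ↔ ∀ s, turns v c.1 s = true := by
  simp only [turns_crossing, smoothing]
  split_ifs with h <;> simp [h]

theorem smoothing_eq_vertical_iff {v : D.State} {c : D.Crossing} :
    smoothing v c = .vertical ↔ ∀ s, turns v c.1 s = false := by
  simp only [turns_crossing, smoothing]
  split_ifs with h <;> simp [h]

theorem smoothing_ne_through (v : D.State) (c : D.Crossing) : smoothing v c ≠ .through := by
  unfold smoothing
  split_ifs <;> simp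

/-- The bottom line (`s = false`) or the top line (`s = true`) of slice `k`. -/
def line (k : Fin D.numSlices) (s : Bool) : Fin (D.numSlices + 1) :=
  bif s then k.succ else k.castSucc

theorem val_line (k : Fin D.numSlices) (s : Bool) : (line k s : ℕ) = k + s.toNat := by
  cases s <;> simp [line]

theorem line_injective (s : Bool) : Function.Injective fun k : Fin D.numSlices => line k s :=
  fun k k' h => Fin.ext (by simpa [val_line] using congrArg Fin.val h)

theorem exists_line_eq (s : Bool) (p : D.Point) : ∃ k, line k s = p.1 := by
  have hp : 0 < D.width p.1 := p.2.pos
  cases s with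
  | false =>
    obtain ⟨k, hk⟩ := Fin.exists_castSucc_eq.2 fun h : p.1 = Fin.last _ =>
      hp.ne' (h ▸ D.width_last)
    exact ⟨k, hk⟩
  | true =>
    obtain ⟨k, hk⟩ := Fin.exists_succ_eq.2 fun h : p.1 = 0 => hp.ne' (h ▸ D.width_zero)
    exact ⟨k, hk⟩

theorem width_line (v : D.State) (k : Fin D.numSlices) (s : Bool) :
    D.pos k + 2 * (turns v k s).toNat ≤ D.width (line k s) ∧
      D.width (line k !s) + 2 * (turns v k s).toNat =
        D.width (line k s) + 2 * (turns v k !s).toNat := by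
  have hfits := D.fits k
  cases hk : D.kind k with
  | cup =>
    rw [hk] at hfits
    obtain ⟨h₁, h₂⟩ := hfits
    cases s <;> simp [turns_cup hk, line] <;> omega
  | cap =>
    rw [hk] at hfits
    obtain ⟨h₁, h₂⟩ := hfits
    cases s <;> simp [turns_cap hk, line] <;> omega
  | cross b =>
    rw [hk] at hfits
    obtain ⟨h₁, h₂⟩ := hfits
    rw [turns_crossing v ⟨k, by rw [hk]; rfl⟩ s, turns_crossing v ⟨k, by rw [hk]; rfl⟩ !s]
    have := ((D.kind k).blOver == v ⟨k, by rw [hk]; rfl⟩).toNat_le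
    cases s <;> simp only [line, cond_true, cond_false, Bool.not_true, Bool.not_false] <;> omega

/-- The other end of the arc in a slice that ends at position `i` of its bottom line (`s = false`)
or top line (`s = true`), where the nontrivial part of the slice is at position `n`, and where `t`
says on which of the two lines there is an arc joining two points of that line. -/
def otherEnd (n : ℕ) (t : Bool → Bool) (s : Bool) (i : ℕ) : Bool × ℕ :=
  if i < n then (!s, i)
  else if t s = true ∧ i < n + 2 then (s, 2 * n + 1 - i)
  else (!s, i + 2 * (t !s).toNat - 2 * (t s).toNat)

theorem otherEnd_symm {n i i' : ℕ} {t : Bool → Bool} {s s' : Bool}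
    (h : otherEnd n t s i = (s', i')) : otherEnd n t s' i' = (s, i) := by
  unfold otherEnd at *
  cases s <;> cases s' <;> cases ht : t false <;> cases ht' : t true <;>
    simp only [ht, ht'] at h ⊢ <;> grind

theorem even_otherEnd {n i i' : ℕ} {t : Bool → Bool} {s s' : Bool}
    (h : otherEnd n t s i = (s', i')) : Even (i' + s'.toNat) ↔ ¬ Even (i + s.toNat) := by
  simp only [Nat.even_iff]
  unfold otherEnd at h
  cases s <;> cases s' <;> cases ht : t false <;> cases ht' : t true <;>
    simp only [ht, ht'] at h <;> grind

/-- In some slice of the smoothing `v`, there is an arc from the point `p` on the side `s` of the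
slice to the point `q` on the side `s'`, where the sides are the bottom (`false`) and the top
(`true`). -/
def Joined (v : D.State) (s : Bool) (p : D.Point) (s' : Bool) (q : D.Point) : Prop :=
  ∃ k, line k s = p.1 ∧ line k s' = q.1 ∧ otherEnd (D.pos k) (turns v k) s p.2 = (s', (q.2 : ℕ))

theorem exists_joined (v : D.State) (s : Bool) (p : D.Point) : ∃ s' q, Joined v s p s' q := by
  obtain ⟨k, hk⟩ := exists_line_eq s p
  suffices h : (otherEnd (D.pos k) (turns v k) s p.2).2 <
      D.width (line k (otherEnd (D.pos k) (turns v k) s p.2).1) from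
    ⟨_, ⟨_, ⟨_, h⟩⟩, k, hk, rfl, rfl⟩
  obtain ⟨h₁, h₂⟩ := width_line v k s
  have hp : (p.2 : ℕ) < D.width (line k s) := by
    rw [hk]
    exact p.2.2
  unfold otherEnd
  cases hs : turns v k s <;> cases hs' : turns v k !s <;>
    simp only [hs, hs', Bool.toNat_true, Bool.toNat_false] at h₁ h₂ ⊢ <;> grind

theorem Joined.symm {v : D.State} {s s' : Bool} {p q : D.Point} (h : Joined v s p s' q) :
    Joined v s' q s p := by
  obtain ⟨k, hp, hq, he⟩ := h
  exact ⟨k, hq, hp, otherEnd_symm he⟩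

theorem Joined.unique {v : D.State} {s s₁ s₂ : Bool} {p q₁ q₂ : D.Point}
    (h₁ : Joined v s p s₁ q₁) (h₂ : Joined v s p s₂ q₂) : s₁ = s₂ ∧ q₁ = q₂ := by
  obtain ⟨k, hp, hq₁, he₁⟩ := h₁
  obtain ⟨k', hp', hq₂, he₂⟩ := h₂
  obtain rfl := line_injective s (hp.trans hp'.symm)
  obtain ⟨rfl, hj⟩ := Prod.ext_iff.1 (he₁.symm.trans he₂)
  exact ⟨rfl, point_ext (hq₁.symm.trans hq₂) hj⟩

theorem Arc.exists_joined {v : D.State} {p q : D.Point} (h : D.Arc (smoothing v) p q) :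
    ∃ s s', Joined v s p s' q := by
  have at_line {k : Fin D.numSlices} {j : ℕ} {s : Bool} {p : D.Point}
      (hp : D.At p (k + s.toNat) j) : line k s = p.1 :=
    Fin.ext ((val_line k s).trans hp.1.symm)
  cases h with
  | left k j p q hj hp hq =>
    exact ⟨false, true, k, at_line hp, at_line hq, by simp [otherEnd, hp.2, hq.2, hj]⟩
  | right_of_cup k j p q hk hj hp hq =>
    exact ⟨false, true, k, at_line hp, at_line hq, by
      simp [otherEnd, hp.2, hq.2, turns_cup hk, hj.not_gt]⟩
  | right_of_cap k j p q hk hj hp hq =>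
    exact ⟨false, true, k, at_line hp, at_line hq, by
      simp [otherEnd, hp.2, hq.2, turns_cap hk, hj.not_gt]; omega⟩
  | right_of_cross c j p q hj hp hq =>
    exact ⟨false, true, c.1, at_line hp, at_line hq, by
      simp [otherEnd, hp.2, hq.2, turns_crossing, hj.not_gt, (le_self_add.trans hj).not_gt]⟩
  | cup k p q hk hp hq =>
    exact ⟨true, true, k, at_line hp, at_line hq, by
      simp [otherEnd, hp.2, hq.2, turns_cup hk]; omega⟩
  | cap k p q hk hp hq =>
    exact ⟨false, false, k, at_line hp, at_line hq, by
      simp [otherEnd, hp.2, hq.2, turns_cap hk]; omega⟩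
  | through₁ c p q hm => exact absurd hm (smoothing_ne_through v c)
  | through₂ c p q hm => exact absurd hm (smoothing_ne_through v c)
  | vertical₁ c p q hm hp hq =>
    exact ⟨false, true, c.1, at_line hp, at_line hq, by
      simp [otherEnd, hp.2, hq.2, smoothing_eq_vertical_iff.1 hm]⟩
  | vertical₂ c p q hm hp hq =>
    exact ⟨false, true, c.1, at_line hp, at_line hq, by
      simp [otherEnd, hp.2, hq.2, smoothing_eq_vertical_iff.1 hm]⟩
  | horizontal₁ c p q hm hp hq =>
    exact ⟨false, false, c.1, at_line hp, at_line hq, by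
      simp [otherEnd, hp.2, hq.2, smoothing_eq_horizontal_iff.1 hm]; omega⟩
  | horizontal₂ c p q hm hp hq =>
    exact ⟨true, true, c.1, at_line hp, at_line hq, by
      simp [otherEnd, hp.2, hq.2, smoothing_eq_horizontal_iff.1 hm]; omega⟩

theorem Joined.arc_of_ne {v : D.State} {p q : D.Point} (h : Joined v false p true q) :
    D.Arc (smoothing v) p q := by
  obtain ⟨k, hp, hq, he⟩ := h
  have at_p {j : ℕ} (hj : (p.2 : ℕ) = j) : D.At p k j := ⟨by rw [← hp, val_line]; rfl, hj⟩
  have at_q {j : ℕ} (hj : (q.2 : ℕ) = j) : D.At q (k + 1) j := ⟨by rw [← hq, val_line]; rfl, hj⟩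
  unfold otherEnd at he
  by_cases hlt : (p.2 : ℕ) < D.pos k
  · rw [if_pos hlt] at he
    exact .left k p.2 p q hlt (at_p rfl) (at_q (Prod.ext_iff.1 he).2.symm)
  rw [if_neg hlt] at he
  cases hk : D.kind k with
  | cup =>
    simp only [turns_cup hk] at he
    exact .right_of_cup k p.2 p q hk (not_lt.1 hlt) (at_p rfl) (at_q (by grind))
  | cap =>
    simp only [turns_cap hk] at he
    exact .right_of_cap k q.2 p q hk (by grind) (at_p (by grind)) (at_q rfl)
  | cross b =>
    obtain ⟨c, rfl⟩ : ∃ c : D.Crossing, c.1 = k := ⟨⟨k, by rw [hk]; rfl⟩, rfl⟩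
    by_cases hright : D.pos c.1 + 2 ≤ p.2
    · exact .right_of_cross c p.2 p q hright (at_p rfl) (at_q (by grind [turns_crossing]))
    have hm : smoothing v c = .vertical :=
      smoothing_eq_vertical_iff.2 fun s => by grind [turns_crossing]
    simp only [smoothing_eq_vertical_iff.1 hm] at he
    by_cases hleft : (p.2 : ℕ) = D.pos c.1
    · exact .vertical₁ c p q hm (at_p hleft) (at_q (by grind))
    · exact .vertical₂ c p q hm (at_p (by grind)) (at_q (by grind))

theorem Joined.arc_of_lt {v : D.State} {s : Bool} {p q : D.Point} (h : Joined v s p s q)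
    (hlt : (p.2 : ℕ) < q.2) : D.Arc (smoothing v) p q := by
  obtain ⟨k, hp, hq, he⟩ := h
  obtain ⟨ht, hpk, hqk⟩ : turns v k s = true ∧ (p.2 : ℕ) = D.pos k ∧ (q.2 : ℕ) = D.pos k + 1 := by
    unfold otherEnd at he
    grind
  have hp' : D.At p (k + s.toNat) (D.pos k) := ⟨by rw [← hp, val_line], hpk⟩
  have hq' : D.At q (k + s.toNat) (D.pos k + 1) := ⟨by rw [← hq, val_line], hqk⟩
  cases hk : D.kind k with
  | cup =>
    obtain rfl : s = true := by rwa [turns_cup hk] at ht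
    exact .cup k p q hk hp' hq'
  | cap =>
    obtain rfl : s = false := by rwa [turns_cap hk, Bool.not_eq_true'] at ht
    exact .cap k p q hk hp' hq'
  | cross b =>
    obtain ⟨c, rfl⟩ : ∃ c : D.Crossing, c.1 = k := ⟨⟨k, by rw [hk]; rfl⟩, rfl⟩
    have hm : smoothing v c = .horizontal :=
      smoothing_eq_horizontal_iff.2 fun s' => by rwa [turns_crossing] at ht ⊢
    cases s
    · exact .horizontal₁ c p q hm hp' hq'
    · exact .horizontal₂ c p q hm hp' hq'

theorem Joined.rel {v : D.State} {s s' : Bool} {p q : D.Point} (h : Joined v s p s' q) :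
    D.curveSetoid (smoothing v) p q := by
  rcases Bool.eq_or_eq_not s s' with rfl | rfl
  · have hne : (p.2 : ℕ) ≠ q.2 := by
      obtain ⟨k, -, -, he⟩ := h
      unfold otherEnd at he
      grind
    rcases hne.lt_or_gt with hlt | hlt
    · exact .rel _ _ (h.arc_of_lt hlt)
    · exact .symm _ _ (.rel _ _ (h.symm.arc_of_lt hlt))
  · cases s'
    · exact .symm _ _ (.rel _ _ h.symm.arc_of_ne)
    · exact .rel _ _ h.arc_of_ne

/-- The checkerboard orientation of the circles of a smoothing leaves the point `p` through the
slice that has `p` on this side: it passes `p` upwards if this is the bottom (`false`), and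
downwards if it is the top (`true`). The parameter `e` exchanges the two colors. -/
def exitSide (e : ℕ) (p : D.Point) : Bool := !decide (Even ((p.2 : ℕ) + e))

theorem exitSide_succ (e : ℕ) (p : D.Point) : exitSide (e + 1) p = !exitSide e p := by
  simp only [exitSide, ← add_assoc, Nat.even_add_one, decide_not]

theorem Joined.exitSide_eq_iff {v : D.State} {s s' : Bool} {p q : D.Point} (e : ℕ)
    (h : Joined v s p s' q) : exitSide e q = s' ↔ exitSide e p = !s := by
  obtain ⟨k, -, -, he⟩ := h
  have hpar := even_otherEnd he
  cases s <;> cases s' <;>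
    simp only [exitSide, Nat.even_add, Bool.toNat_false, Bool.toNat_true, Nat.not_even_one,
      Even.zero, Bool.not_eq_true', Bool.not_eq_false', decide_eq_true_eq, decide_eq_false_iff_not,
      Bool.not_true, Bool.not_false] at hpar ⊢ <;> tauto

theorem exists_next (e : ℕ) (v : D.State) (p : D.Point) :
    ∃ q, Joined v (exitSide e p) p (!exitSide e q) q := by
  obtain ⟨s', q, h⟩ := exists_joined v (exitSide e p) p
  have hs' : exitSide e q = !s' := by
    have := h.exitSide_eq_iff e
    grind
  exact ⟨q, by rwa [hs', Bool.not_not]⟩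

/-- The permutation that moves each point to the next one along its circle, with respect to the
checkerboard orientation. -/
noncomputable def next (e : ℕ) (v : D.State) : Equiv.Perm D.Point where
  toFun p := (exists_next e v p).choose
  invFun p := (exists_next (e + 1) v p).choose
  left_inv p := by
    have h₁ := (exists_next e v p).choose_spec
    have h₂ : Joined v (exitSide (e + 1) (exists_next e v p).choose) (exists_next e v p).choose
        (exitSide e p) p := by
      rw [exitSide_succ]
      exact h₁.symm
    exact ((exists_next (e + 1) v _).choose_spec.unique h₂).2
  right_inv p := by
    have h₁ := (exists_next (e + 1) v p).choose_spec
    have h₂ : Joined v (exitSide e (exists_next (e + 1) v p).choose)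
        (exists_next (e + 1) v p).choose (exitSide (e + 1) p) p := by
      rw [← Bool.not_not (exitSide e _), ← exitSide_succ]
      exact h₁.symm
    exact ((exists_next e v _).choose_spec.unique h₂).2

theorem joined_next (e : ℕ) (v : D.State) (p : D.Point) :
    Joined v (exitSide e p) p (!exitSide e (next e v p)) (next e v p) :=
  (exists_next e v p).choose_spec

theorem Joined.next_eq {e : ℕ} {v : D.State} {s' : Bool} {p q : D.Point}
    (h : Joined v (exitSide e p) p s' q) : next e v p = q :=
  ((joined_next e v p).unique h).2

theorem Joined.sameCycle_next {v : D.State} {s s' : Bool} {p q : D.Point}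
    (h : Joined v s p s' q) (e : ℕ) : (next e v).SameCycle p q := by
  have next_eq {s s' : Bool} {p q : D.Point} (h : Joined v s p s' q) (hs : exitSide e p = s) :
      (next e v).SameCycle p q := ⟨1, by subst hs; exact h.next_eq⟩
  by_cases hs : exitSide e p = s
  · exact next_eq h hs
  · exact (next_eq h.symm ((h.exitSide_eq_iff e).2 (Bool.eq_not_of_ne hs))).symm

theorem rel_iff_sameCycle_next (e : ℕ) (v : D.State) {p q : D.Point} :
    D.curveSetoid (smoothing v) p q ↔ (next e v).SameCycle p q := by
  constructor
  · intro h
    induction h with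
    | refl => exact .refl _ _
    | symm _ _ _ ih => exact ih.symm
    | trans _ _ _ _ _ ih₁ ih₂ => exact ih₁.trans ih₂
    | rel p q h =>
      obtain ⟨s, s', h⟩ := h.exists_joined
      exact h.sameCycle_next e
  · intro h
    obtain ⟨n, rfl⟩ := h.exists_nat_pow_eq
    clear h
    induction n with
    | zero => exact .refl _
    | succ n ih =>
      rw [pow_succ', Equiv.Perm.mul_apply]
      exact .trans _ _ _ ih (joined_next e v _).rel

/-- The top left endpoint of a crossing. -/
def tl (c : D.Crossing) : D.Point := ⟨c.1.succ, ⟨D.pos c.1, (Nat.lt_succ_self _).trans (tr c).2.2⟩⟩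

theorem bl_ne_tr (c : D.Crossing) : bl c ≠ tr c := fun h =>
  (Fin.castSucc_lt_succ (i := c.1)).ne (congrArg Sigma.fst h)

/-- The two arcs that the mode `m` puts into the crossing `c`, with the direction that they have in
`LinkDiagram.Arc`. -/
def Connects (c : D.Crossing) (m : CrossingMode) (p q : D.Point) : Prop :=
  match m with
  | .through => p = bl c ∧ q = tr c ∨ p = br c ∧ q = tl c
  | .vertical => p = bl c ∧ q = tl c ∨ p = br c ∧ q = tr c
  | .horizontal => p = bl c ∧ q = br c ∨ p = tl c ∧ q = tr c

theorem Connects.arc {m : D.Crossing → CrossingMode} {c : D.Crossing} {p q : D.Point}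
    (h : Connects c (m c) p q) : D.Arc m p q := by
  cases hm : m c <;> rw [hm] at h <;> rcases h with ⟨rfl, rfl⟩ | ⟨rfl, rfl⟩
  · exact .through₁ c _ _ hm ⟨rfl, rfl⟩ ⟨rfl, rfl⟩
  · exact .through₂ c _ _ hm ⟨rfl, rfl⟩ ⟨rfl, rfl⟩
  · exact .vertical₁ c _ _ hm ⟨rfl, rfl⟩ ⟨rfl, rfl⟩
  · exact .vertical₂ c _ _ hm ⟨rfl, rfl⟩ ⟨rfl, rfl⟩
  · exact .horizontal₁ c _ _ hm ⟨rfl, rfl⟩ ⟨rfl, rfl⟩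
  · exact .horizontal₂ c _ _ hm ⟨rfl, rfl⟩ ⟨rfl, rfl⟩

theorem Arc.forall_or_exists_connects {m : D.Crossing → CrossingMode} {p q : D.Point}
    (h : D.Arc m p q) : (∀ m', D.Arc m' p q) ∨ ∃ c, Connects c (m c) p q := by
  cases h with
  | left k j p q hj hp hq => exact .inl fun _ => .left k j p q hj hp hq
  | right_of_cup k j p q hk hj hp hq => exact .inl fun _ => .right_of_cup k j p q hk hj hp hq
  | right_of_cap k j p q hk hj hp hq => exact .inl fun _ => .right_of_cap k j p q hk hj hp hq
  | right_of_cross c j p q hj hp hq => exact .inl fun _ => .right_of_cross c j p q hj hp hq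
  | cup k p q hk hp hq => exact .inl fun _ => .cup k p q hk hp hq
  | cap k p q hk hp hq => exact .inl fun _ => .cap k p q hk hp hq
  | through₁ c p q hm hp hq | vertical₁ c p q hm hp hq | horizontal₁ c p q hm hp hq =>
    refine .inr ⟨c, ?_⟩
    rw [hm]
    exact .inl ⟨at_unique hp ⟨rfl, rfl⟩, at_unique hq ⟨rfl, rfl⟩⟩
  | through₂ c p q hm hp hq | vertical₂ c p q hm hp hq | horizontal₂ c p q hm hp hq =>
    refine .inr ⟨c, ?_⟩
    rw [hm]
    exact .inr ⟨at_unique hp ⟨rfl, rfl⟩, at_unique hq ⟨rfl, rfl⟩⟩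

/-- The states `v` and `w` differ at the crossing `c` and nowhere else. -/
structure Adjacent (c : D.Crossing) (v w : D.State) : Prop where
  eq_off : ∀ c', c' ≠ c → v c' = w c'
  ne : v c ≠ w c

theorem adjacent_update [DecidableEq D.Crossing] {c : D.Crossing} {v : D.State} {b : Bool}
    (h : v c ≠ b) : Adjacent c v (Function.update v c b) :=
  ⟨fun c' hc => by rw [Function.update_of_ne hc], by rwa [Function.update_self]⟩

/-- The circle of `p` in the smoothing `v` runs through the crossing `c`. -/
def Meets (v : D.State) (c : D.Crossing) (p : D.Point) : Prop :=
  D.curveSetoid (smoothing v) p (bl c) ∨ D.curveSetoid (smoothing v) p (tr c)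

theorem Meets.of_rel {v : D.State} {c : D.Crossing} {p q : D.Point}
    (h : D.curveSetoid (smoothing v) p q) (hq : Meets v c q) : Meets v c p :=
  hq.imp (.trans _ _ _ h) (.trans _ _ _ h)

theorem Connects.meets {c : D.Crossing} {m : CrossingMode} {p q : D.Point} (h : Connects c m p q)
    (v : D.State) : Meets v c p ∧ Meets v c q := by
  have hbl : Meets v c (bl c) := .inl (.refl _)
  have htr : Meets v c (tr c) := .inr (.refl _)
  have rel {p q : D.Point} (h : Connects c (smoothing v c) p q) :
      D.curveSetoid (smoothing v) p q := .rel _ _ h.arc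
  obtain ⟨hbr, htl⟩ : Meets v c (br c) ∧ Meets v c (tl c) := by
    cases hv : smoothing v c with
    | through => exact absurd hv (smoothing_ne_through v c)
    | vertical =>
      rw [hv] at rel
      exact ⟨htr.of_rel (rel (.inr ⟨rfl, rfl⟩)), hbl.of_rel (.symm _ _ (rel (.inl ⟨rfl, rfl⟩)))⟩
    | horizontal =>
      rw [hv] at rel
      exact ⟨hbl.of_rel (.symm _ _ (rel (.inl ⟨rfl, rfl⟩))), htr.of_rel (rel (.inr ⟨rfl, rfl⟩))⟩
  cases m <;> rcases h with ⟨rfl, rfl⟩ | ⟨rfl, rfl⟩ <;> exact ⟨by assumption, by assumption⟩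

theorem otherEnd_const {n i : ℕ} (b s : Bool) (h : i < n ∨ n + 2 ≤ i) :
    otherEnd n (fun _ => b) s i = (!s, i) := by
  unfold otherEnd
  grind

theorem joined_bl (v : D.State) (c : D.Crossing) :
    if turns v c.1 false = true then Joined v false (bl c) false (br c)
    else Joined v false (bl c) true (tl c) := by
  split_ifs with h
  · exact ⟨c.1, rfl, rfl, by simp [otherEnd, bl, br, h]; omega⟩
  · rw [turns_crossing] at h
    exact ⟨c.1, rfl, rfl, by simp [otherEnd, bl, tl, turns_crossing, h]⟩

theorem joined_tr (v : D.State) (c : D.Crossing) :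
    if turns v c.1 false = true then Joined v true (tr c) true (tl c)
    else Joined v true (tr c) false (br c) := by
  rw [turns_crossing]
  split_ifs with h
  · exact ⟨c.1, rfl, rfl, by simp [otherEnd, tr, tl, turns_crossing, h]; omega⟩
  · exact ⟨c.1, rfl, rfl, by simp [otherEnd, tr, br, turns_crossing, h]⟩

theorem exitSide_bl (c : D.Crossing) : exitSide (D.pos c.1) (bl c) = false := by
  simp [exitSide, bl]

theorem exitSide_tr (c : D.Crossing) : exitSide (D.pos c.1) (tr c) = true := by
  simp only [exitSide, tr, Nat.even_iff, Bool.not_eq_true', decide_eq_false_iff_not]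
  omega

namespace Adjacent

variable {c : D.Crossing} {v w : D.State}

theorem symm (h : Adjacent c v w) : Adjacent c w v :=
  ⟨fun c' hc => (h.eq_off c' hc).symm, h.ne.symm⟩

theorem turns_of_ne (h : Adjacent c v w) {k : Fin D.numSlices} (hk : k ≠ c.1) :
    turns v k = turns w k := by
  ext1 s
  cases hkind : D.kind k with
  | cup => rw [turns_cup hkind, turns_cup hkind]
  | cap => rw [turns_cap hkind, turns_cap hkind]
  | cross b =>
    obtain ⟨c', rfl⟩ : ∃ c' : D.Crossing, c'.1 = k := ⟨⟨k, by rw [hkind]; rfl⟩, rfl⟩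
    rw [turns_crossing, turns_crossing, h.eq_off c' fun he => hk (congrArg _ he)]

theorem turns_crossing_eq_not (h : Adjacent c v w) (s : Bool) :
    turns w c.1 s = !turns v c.1 s := by
  rw [turns_crossing, turns_crossing, Bool.eq_not_of_ne h.ne.symm]
  cases (D.kind c.1).blOver <;> cases v c <;> rfl

theorem joined (h : Adjacent c v w) {p q : D.Point} {s' : Bool} (hbl : p ≠ bl c) (htr : p ≠ tr c)
    (hpq : Joined v (exitSide (D.pos c.1) p) p s' q) :
    Joined w (exitSide (D.pos c.1) p) p s' q := by
  obtain ⟨k, hp, hq, he⟩ := hpq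
  refine ⟨k, hp, hq, ?_⟩
  by_cases hk : k = c.1
  swap
  · rwa [← h.turns_of_ne hk]
  subst hk
  have hne : (p.2 : ℕ) < D.pos c.1 ∨ D.pos c.1 + 2 ≤ p.2 := by
    by_contra! hnear
    cases hs : exitSide (D.pos c.1) p <;> rw [hs] at hp <;>
      simp only [exitSide, Bool.not_eq_true', Bool.not_eq_false', decide_eq_true_eq,
        decide_eq_false_iff_not, Nat.even_iff] at hs
    · exact hbl (point_ext hp.symm (show (p.2 : ℕ) = D.pos c.1 by omega))
    · exact htr (point_ext hp.symm (show (p.2 : ℕ) = D.pos c.1 + 1 by omega))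
  have hconst (v : D.State) : turns v c.1 = fun _ => (D.kind c.1).blOver == v c :=
    funext (turns_crossing v c)
  rw [hconst, otherEnd_const _ _ hne] at he ⊢
  exact he

open Classical in
theorem next_eq (h : Adjacent c v w) :
    next (D.pos c.1) w = next (D.pos c.1) v * Equiv.swap (bl c) (tr c) := by
  ext1 p
  rw [Equiv.Perm.mul_apply]
  have hnext {v : D.State} {p q : D.Point} {s s' : Bool} (hs : exitSide (D.pos c.1) p = s)
      (hpq : Joined v s p s' q) : next (D.pos c.1) v p = q := by
    subst hs
    exact hpq.next_eq
  have hbl (v : D.State) :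
      next (D.pos c.1) v (bl c) = if turns v c.1 false = true then br c else tl c := by
    have := joined_bl v c
    split_ifs at this ⊢ <;> exact hnext (exitSide_bl c) this
  have htr (v : D.State) :
      next (D.pos c.1) v (tr c) = if turns v c.1 false = true then tl c else br c := by
    have := joined_tr v c
    split_ifs at this ⊢ <;> exact hnext (exitSide_tr c) this
  by_cases hp : p = bl c
  · subst hp
    rw [Equiv.swap_apply_left, hbl, htr, h.turns_crossing_eq_not]
    cases turns v c.1 false <;> rfl
  by_cases hp' : p = tr c
  · subst hp'
    rw [Equiv.swap_apply_right, hbl, htr, h.turns_crossing_eq_not]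
    cases turns v c.1 false <;> rfl
  rw [Equiv.swap_apply_of_ne_of_ne hp hp']
  exact (h.joined hp hp' (joined_next _ v p)).next_eq

theorem rel_bl_tr_iff (h : Adjacent c v w) :
    D.curveSetoid (smoothing w) (bl c) (tr c) ↔ ¬ D.curveSetoid (smoothing v) (bl c) (tr c) := by
  classical
  rw [rel_iff_sameCycle_next (D.pos c.1), rel_iff_sameCycle_next (D.pos c.1), h.next_eq]
  exact sameCycle_mul_swap_iff (bl_ne_tr c)

theorem rel (h : Adjacent c v w) {p q : D.Point} (hpq : D.curveSetoid (smoothing v) p q) :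
    D.curveSetoid (smoothing w) p q ∨ Meets w c p ∧ Meets w c q := by
  induction hpq with
  | rel p q hpq =>
    obtain hpq | ⟨c', hpq⟩ := hpq.forall_or_exists_connects
    · exact .inl (.rel _ _ (hpq _))
    · rcases eq_or_ne c' c with rfl | hc
      · exact .inr (hpq.meets w)
      · rw [smoothing, h.eq_off c' hc] at hpq
        exact .inl (.rel _ _ (Connects.arc (m := smoothing w) hpq))
  | refl p => exact .inl (.refl p)
  | symm p q _ ih => exact ih.imp (.symm _ _) And.symm
  | trans p q r _ _ ih₁ ih₂ =>
    rcases ih₁ with ih₁ | ih₁ <;> rcases ih₂ with ih₂ | ih₂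
    · exact .inl (.trans _ _ _ ih₁ ih₂)
    · exact .inr ⟨.of_rel ih₁ ih₂.1, ih₂.2⟩
    · exact .inr ⟨ih₁.1, .of_rel (.symm _ _ ih₂) ih₁.2⟩
    · exact .inr ⟨ih₁.1, ih₂.2⟩

theorem meets (h : Adjacent c v w) {p : D.Point} (hp : Meets v c p) : Meets w c p :=
  hp.elim (fun hp => (h.rel hp).elim .inl And.left) fun hp => (h.rel hp).elim .inr And.left

theorem meets_iff (h : Adjacent c v w) {p : D.Point} : Meets v c p ↔ Meets w c p :=
  ⟨h.meets, h.symm.meets⟩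

theorem rel_iff_of_rel (h : Adjacent c v w) (hw : D.curveSetoid (smoothing w) (bl c) (tr c))
    {p q : D.Point} : D.curveSetoid (smoothing w) p q ↔
      D.curveSetoid (smoothing v) p q ∨ Meets v c p ∧ Meets v c q := by
  have rel_bl {p : D.Point} (hp : Meets w c p) : D.curveSetoid (smoothing w) p (bl c) :=
    hp.elim id fun hp => .trans _ _ _ hp (.symm _ _ hw)
  have rel_of_meets {p q : D.Point} (hp : Meets w c p ∧ Meets w c q) :
      D.curveSetoid (smoothing w) p q :=
    .trans _ _ _ (rel_bl hp.1) (.symm _ _ (rel_bl hp.2))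
  exact ⟨h.symm.rel, fun hpq => hpq.elim (fun hpq => (h.rel hpq).elim id rel_of_meets)
    fun hpq => rel_of_meets (hpq.imp h.meets h.meets)⟩

theorem card_circle (h : Adjacent c v w) (hw : D.curveSetoid (smoothing w) (bl c) (tr c)) :
    Nat.card (Circle v) = Nat.card (Circle w) + 1 :=
  card_quotient_eq_add_one (h.rel_bl_tr_iff.1 hw) fun _ _ => h.rel_iff_of_rel hw

end Adjacent

/-- The labeling `f` of the points is constant on the circles of the smoothing `v`. Such a
labeling stands for the character `X ↦ f` of `A^{⊗ circles of v}`. -/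
def Compat (v : D.State) (f : D.Point → Bool) : Prop :=
  ∀ p q, D.curveSetoid (smoothing v) p q → f p = f q

theorem compat_of_arc {v : D.State} {f : D.Point → Bool}
    (h : ∀ p q, D.Arc (smoothing v) p q → f p = f q) : Compat v f := by
  intro p q hpq
  induction hpq with
  | rel p q hpq => exact h p q hpq
  | refl => rfl
  | symm _ _ _ ih => exact ih.symm
  | trans _ _ _ _ _ ih₁ ih₂ => exact ih₁.trans ih₂

theorem Adjacent.compat {c : D.Crossing} {v w : D.State} (h : Adjacent c v w) {f : D.Point → Bool}
    (hf : Compat w f) (hc : f (bl c) = f (tr c)) : Compat v f := by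
  have eq_bl {p : D.Point} (hp : Meets w c p) : f p = f (bl c) :=
    hp.elim (hf _ _) fun hp => (hf _ _ hp).trans hc.symm
  exact fun p q hpq => (h.rel hpq).elim (hf _ _) fun hm => (eq_bl hm.1).trans (eq_bl hm.2).symm

/-- The value of the basis element `x` of `A` under the character `X ↦ a` of `A`. -/
def charValue (a x : Bool) : ℤ := if x = true → a = true then 1 else 0

theorem charValue_mul_self (a x : Bool) : charValue a x * charValue a x = charValue a x := by
  cases a <;> cases x <;> rfl

theorem sum_charValue_mul_mulCoeff (a x y : Bool) :
    ∑ z, charValue a z * mulCoeff x y z = charValue a x * charValue a y := by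
  cases a <;> cases x <;> cases y <;> rfl

theorem sum_charValue_mul_comulCoeff (a b x : Bool) :
    ∑ y, ∑ z, charValue a y * charValue b z * comulCoeff x y z =
      if a = b then (if a = true then 1 else -1) * charValue a x else 0 := by
  cases a <;> cases b <;> cases x <;> rfl

open Classical in
/-- The value of the enhanced state `s` under the character `f`. -/
noncomputable def evalState (f : D.Point → Bool) (s : D.EnhancedState) : ℤ :=
  if ∀ p : D.Point, s.2 ⟦p⟧ = true → f p = true then 1 else 0

open Classical in
/-- The factor that the circles away from the crossing `c` contribute to `evalState f s`. -/
noncomputable def evalOff (f : D.Point → Bool) (c : D.Crossing) (s : D.EnhancedState) : ℤ :=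
  if ∀ p, ¬ Meets s.1 c p → s.2 ⟦p⟧ = true → f p = true then 1 else 0

theorem evalState_eq_mul {f : D.Point → Bool} {s : D.EnhancedState} (hf : Compat s.1 f)
    (c : D.Crossing) : evalState f s =
      charValue (f (bl c)) (s.2 ⟦bl c⟧) * charValue (f (tr c)) (s.2 ⟦tr c⟧) * evalOff f c s := by
  classical
  have forall_iff : (∀ p : D.Point, s.2 ⟦p⟧ = true → f p = true) ↔
      ((s.2 ⟦bl c⟧ = true → f (bl c) = true) ∧ (s.2 ⟦tr c⟧ = true → f (tr c) = true)) ∧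
        ∀ p, ¬ Meets s.1 c p → s.2 ⟦p⟧ = true → f p = true := by
    refine ⟨fun hp => ⟨⟨hp _, hp _⟩, fun p _ => hp p⟩, fun ⟨⟨hbl, htr⟩, hoff⟩ p => ?_⟩
    by_cases hp : Meets s.1 c p
    · rcases hp with hp | hp <;> rw [hf _ _ hp, Quotient.sound hp] <;> assumption
    · exact hoff p hp
  simp only [evalState, evalOff, charValue, ite_zero_mul_ite_zero, mul_one, forall_iff]

/-- The labels of `s`, changed to `α` and `β` on the circles of `bl c` and `tr c`. -/
noncomputable def relabel {c : D.Crossing} {w : D.State} (s : D.EnhancedState)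
    (h : Adjacent c s.1 w) (α β : Bool) : D.EnhancedState := by
  classical
  exact ⟨w, Quotient.lift (fun p => if D.curveSetoid (smoothing w) p (bl c) then α else
    if D.curveSetoid (smoothing w) p (tr c) then β else s.2 ⟦p⟧) fun p q hpq => by
      have hr (r : D.Point) : D.curveSetoid (smoothing w) p r ↔ D.curveSetoid (smoothing w) q r :=
        ⟨.trans _ _ _ (.symm _ _ hpq), .trans _ _ _ hpq⟩
      simp only [hr]
      split_ifs with hbl htr
      · rfl
      · rfl
      · exact congrArg s.2 (Quotient.sound ((h.symm.rel hpq).resolve_right fun hm =>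
          (h.meets hm.2).elim hbl htr))⟩

section Relabel

variable {c : D.Crossing} {w : D.State} {s : D.EnhancedState} (h : Adjacent c s.1 w)

theorem relabel_bl (α β : Bool) : (relabel s h α β).2 ⟦bl c⟧ = α :=
  if_pos (.refl _)

theorem relabel_tr_of_not_rel (hw : ¬ D.curveSetoid (smoothing w) (bl c) (tr c)) (α β : Bool) :
    (relabel s h α β).2 ⟦tr c⟧ = β :=
  (if_neg fun h => hw (.symm _ _ h)).trans (if_pos (.refl _))

theorem relabel_tr_of_rel (hw : D.curveSetoid (smoothing w) (bl c) (tr c)) (α β : Bool) :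
    (relabel s h α β).2 ⟦tr c⟧ = α :=
  if_pos (.symm _ _ hw)

theorem relabel_of_not_meets {p : D.Point} (hp : ¬ Meets w c p) (α β : Bool) :
    (relabel s h α β).2 ⟦p⟧ = s.2 ⟦p⟧ :=
  (if_neg fun h => hp (.inl h)).trans (if_neg fun h => hp (.inr h))

theorem eq_relabel {y : Circle w → Bool} (hy : ∀ p, ¬ Meets w c p → s.2 ⟦p⟧ = y ⟦p⟧) :
    (⟨w, y⟩ : D.EnhancedState) = relabel s h (y ⟦bl c⟧) (y ⟦tr c⟧) := by
  classical
  refine Sigma.ext rfl (heq_of_eq (funext fun C => ?_))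
  induction C using Quotient.inductionOn with
  | h p =>
    by_cases hbl : D.curveSetoid (smoothing w) p (bl c)
    · exact (congrArg y (Quotient.sound hbl)).trans (if_pos hbl).symm
    by_cases htr : D.curveSetoid (smoothing w) p (tr c)
    · exact (congrArg y (Quotient.sound htr)).trans ((if_neg hbl).trans (if_pos htr)).symm
    have hp : ¬ Meets w c p := not_or.2 ⟨hbl, htr⟩
    exact (hy p hp).symm.trans (relabel_of_not_meets h hp _ _).symm

theorem evalOff_relabel (f : D.Point → Bool) (α β : Bool) :
    evalOff f c (relabel s h α β) = evalOff f c s := by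
  have hp (p : D.Point) : (¬ Meets w c p → (relabel s h α β).2 ⟦p⟧ = true → f p = true) ↔
      (¬ Meets s.1 c p → s.2 ⟦p⟧ = true → f p = true) := by
    rw [h.meets_iff]
    exact forall_congr' fun hp => by rw [relabel_of_not_meets h hp]
  classical
  unfold evalOff
  exact if_congr (forall_congr' hp) rfl rfl

theorem forall_ne_mk_iff {v : D.State} {P : D.Point → Prop} :
    (∀ p, (⟦p⟧ : Circle v) ≠ ⟦bl c⟧ → (⟦p⟧ : Circle v) ≠ ⟦tr c⟧ → P p) ↔
      ∀ p, ¬ Meets v c p → P p := by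
  refine forall_congr' fun p => ?_
  rw [Meets, not_or, and_imp]
  exact imp_congr (not_congr Quotient.eq) (imp_congr (not_congr Quotient.eq) .rfl)

theorem saddleCoeff_relabel_of_not_rel (hw : ¬ D.curveSetoid (smoothing w) (bl c) (tr c))
    (α β : Bool) : saddleCoeff c s (relabel s h α β) = comulCoeff (s.2 ⟦bl c⟧) α β := by
  have hv : (⟦bl c⟧ : Circle s.1) = ⟦tr c⟧ := Quotient.sound (h.symm.rel_bl_tr_iff.2 hw)
  have hw' : (⟦bl c⟧ : Circle (relabel s h α β).1) ≠ ⟦tr c⟧ := fun he => hw (Quotient.exact he)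
  have hoff := forall_ne_mk_iff.2 fun p hp =>
    (relabel_of_not_meets h (mt h.meets_iff.2 hp) α β).symm
  rw [saddleCoeff, if_pos hoff, if_neg (not_not.2 hv), if_pos hw', relabel_bl,
    relabel_tr_of_not_rel h hw]

theorem saddleCoeff_relabel_of_rel (hw : D.curveSetoid (smoothing w) (bl c) (tr c))
    (α β : Bool) :
    saddleCoeff c s (relabel s h α β) = mulCoeff (s.2 ⟦bl c⟧) (s.2 ⟦tr c⟧) α := by
  have hv : (⟦bl c⟧ : Circle s.1) ≠ ⟦tr c⟧ := fun he => h.rel_bl_tr_iff.1 hw (Quotient.exact he)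
  have hoff := forall_ne_mk_iff.2 fun p hp =>
    (relabel_of_not_meets h (mt h.meets_iff.2 hp) α β).symm
  rw [saddleCoeff, if_pos hoff, if_pos hv, relabel_bl]

theorem eq_relabel_of_saddleCoeff_ne_zero {t : D.EnhancedState} (ht : t.1 = w)
    (h₀ : saddleCoeff c s t ≠ 0) : t = relabel s h (t.2 ⟦bl c⟧) (t.2 ⟦tr c⟧) := by
  obtain ⟨w', y⟩ := t
  obtain rfl : w' = w := ht
  refine eq_relabel h fun p hp => ?_
  have hoff := forall_ne_mk_iff.1 (not_imp_comm.1 (fun h => if_neg h) h₀)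
  exact hoff p (mt h.meets_iff.1 hp)

end Relabel

theorem sum_eq_sum_relabel_of_not_rel {M : Type*} [AddCommMonoid M] {c : D.Crossing} {w : D.State}
    {s : D.EnhancedState} (h : Adjacent c s.1 w)
    (hw : ¬ D.curveSetoid (smoothing w) (bl c) (tr c)) {g : D.EnhancedState → M}
    (hg : ∀ t, g t ≠ 0 → t = relabel s h (t.2 ⟦bl c⟧) (t.2 ⟦tr c⟧)) :
    ∑ t, g t = ∑ α, ∑ β, g (relabel s h α β) := by
  have hinj : Function.Injective fun x : Bool × Bool => relabel s h x.1 x.2 := fun x y hxy => by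
    have hbl := congrArg (fun t : D.EnhancedState => t.2 ⟦bl c⟧) hxy
    have htr := congrArg (fun t : D.EnhancedState => t.2 ⟦tr c⟧) hxy
    simp only [relabel_bl, relabel_tr_of_not_rel h hw] at hbl htr
    exact Prod.ext hbl htr
  rw [← Fintype.sum_prod_type', ← Fintype.sum_of_injective _ hinj _ g _ fun _ => rfl]
  exact fun t ht => by_contra fun h₀ => ht ⟨(_, _), (hg t h₀).symm⟩

theorem sum_eq_sum_relabel_of_rel {M : Type*} [AddCommMonoid M] {c : D.Crossing} {w : D.State}
    {s : D.EnhancedState} (h : Adjacent c s.1 w)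
    (hw : D.curveSetoid (smoothing w) (bl c) (tr c)) {g : D.EnhancedState → M}
    (hg : ∀ t, g t ≠ 0 → t = relabel s h (t.2 ⟦bl c⟧) (t.2 ⟦tr c⟧)) :
    ∑ t, g t = ∑ α, g (relabel s h α α) := by
  have hinj : Function.Injective fun α : Bool => relabel s h α α := fun α β hαβ => by
    have hbl := congrArg (fun t : D.EnhancedState => t.2 ⟦bl c⟧) hαβ
    simpa only [relabel_bl] using hbl
  rw [← Fintype.sum_of_injective _ hinj _ g _ fun _ => rfl]
  refine fun t ht => by_contra fun h₀ => ht ⟨t.2 ⟦bl c⟧, ?_⟩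
  have htr := congrArg (fun t : D.EnhancedState => t.2 ⟦tr c⟧) (hg t h₀)
  simp only [relabel_tr_of_rel h hw] at htr
  have := hg t h₀
  rw [htr] at this
  exact this.symm

open Classical in
/-- The factor by which the saddle at `c` multiplies the idempotent with the labeling `f`. -/
noncomputable def saddleSign (f : D.Point → Bool) (v : D.State) (c : D.Crossing) : ℤ :=
  if D.curveSetoid (smoothing v) (bl c) (tr c) ∧ f (bl c) = false then -1 else 1

open Classical in
/-- In the basis of idempotents, the saddle maps are diagonal. -/
theorem sum_evalState_mul_saddleCoeff {c : D.Crossing} {w : D.State} {s : D.EnhancedState}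
    (h : Adjacent c s.1 w) {f : D.Point → Bool} (hf : Compat w f) :
    ∑ t with t.1 = w, evalState f t * saddleCoeff c s t =
      if f (bl c) = f (tr c) then saddleSign f s.1 c * evalState f s else 0 := by
  have eq_relabel (t) (ht : (if t.1 = w then evalState f t * saddleCoeff c s t else 0) ≠ 0) :
      t = relabel s h (t.2 ⟦bl c⟧) (t.2 ⟦tr c⟧) := by
    obtain ⟨htw, h₀⟩ := ite_ne_right_iff.1 ht
    exact eq_relabel_of_saddleCoeff_ne_zero h htw (right_ne_zero_of_mul h₀)
  have eval_relabel (α β) := evalState_eq_mul (s := relabel s h α β) hf c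
  have hs : f (bl c) = f (tr c) → evalState f s = _ := fun hc =>
    evalState_eq_mul (h.compat hf hc) c
  have hw (α β) : (relabel s h α β).1 = w := rfl
  rw [Finset.sum_filter]
  by_cases hrel : D.curveSetoid (smoothing w) (bl c) (tr c)
  · have hc := hf _ _ hrel
    simp only [sum_eq_sum_relabel_of_rel h hrel eq_relabel, hw, if_true, eval_relabel, relabel_bl,
      relabel_tr_of_rel h hrel, evalOff_relabel, saddleCoeff_relabel_of_rel h hrel,
      hs hc, saddleSign, h.rel_bl_tr_iff.1 hrel, false_and, if_false, ← hc, charValue_mul_self,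
      mul_right_comm _ (evalOff f c s), ← Finset.sum_mul, sum_charValue_mul_mulCoeff, one_mul]
  · have hrel' := h.symm.rel_bl_tr_iff.2 hrel
    simp only [sum_eq_sum_relabel_of_not_rel h hrel eq_relabel, hw, if_true, eval_relabel,
      relabel_bl, relabel_tr_of_not_rel h hrel, evalOff_relabel,
      saddleCoeff_relabel_of_not_rel h hrel, mul_right_comm _ (evalOff f c s), ← Finset.sum_mul,
      sum_charValue_mul_comulCoeff]
    by_cases hc : f (bl c) = f (tr c)
    · have htr : s.2 ⟦tr c⟧ = s.2 ⟦bl c⟧ := congrArg s.2 (Quotient.sound (.symm _ _ hrel'))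
      rw [if_pos hc, if_pos hc, hs hc, ← hc, htr, charValue_mul_self, saddleSign]
      cases f (bl c) <;> simp [hrel']
    · simp only [hc, if_false, zero_mul]

open Classical in
/-- The sign of the edge that leaves the vertex `v` of the cube of smoothings in direction `c`. -/
noncomputable def cubeSign (v : D.State) (c : D.Crossing) : ℤ :=
  (-1) ^ (Finset.univ.filter fun c' : D.Crossing => c' < c ∧ v c' = true).card

theorem cubeSign_update_of_lt {v : D.State} {c c' : D.Crossing} (hc : v c = false) (h : c < c') :
    cubeSign (Function.update v c true) c' = -cubeSign v c' := by
  classical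
  have insert_eq : (Finset.univ.filter fun b => b < c' ∧ Function.update v c true b = true) =
      insert c (Finset.univ.filter fun b => b < c' ∧ v b = true) := by
    ext b
    rcases eq_or_ne b c with rfl | hb
    · simp [h]
    · simp [hb]
  rw [cubeSign, insert_eq, Finset.card_insert_of_notMem (by simp [hc]), pow_succ, mul_neg_one,
    cubeSign]

theorem cubeSign_update_of_not_lt {v : D.State} {c c' : D.Crossing} (h : ¬ c < c') :
    cubeSign (Function.update v c true) c' = cubeSign v c' := by
  classical
  unfold cubeSign
  congr 2
  ext b
  rcases eq_or_ne b c with rfl | hb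
  · simp [h]
  · simp [hb]

theorem cubeSign_anticomm {v : D.State} {c c' : D.Crossing} (hne : c ≠ c') (hc : v c = false)
    (hc' : v c' = false) :
    cubeSign (Function.update v c true) c' * cubeSign v c =
      -(cubeSign (Function.update v c' true) c * cubeSign v c') := by
  rcases lt_or_gt_of_ne hne with h | h
  · rw [cubeSign_update_of_lt hc h, cubeSign_update_of_not_lt h.not_gt]
    ring
  · rw [cubeSign_update_of_lt hc' h, cubeSign_update_of_not_lt h.not_gt]
    ring

theorem Adjacent.rel_of_apply_ne {c c' : D.Crossing} {v w : D.State} (h : Adjacent c' v w)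
    {f : D.Point → Bool} (hf : Compat w f) (hc' : f (bl c') = f (tr c'))
    (hne : f (bl c) ≠ f (bl c')) (hr : D.curveSetoid (smoothing v) (bl c) (tr c)) :
    D.curveSetoid (smoothing w) (bl c) (tr c) :=
  (h.rel hr).resolve_right fun hm =>
    hne (hm.1.elim (hf _ _) fun hm => (hf _ _ hm).trans hc'.symm)

theorem Adjacent.saddleSign_eq_of_apply_ne {c c' : D.Crossing} {v w : D.State}
    (h : Adjacent c' v w) {f : D.Point → Bool} (hf : Compat v f) (hc' : f (bl c') = f (tr c'))
    (hne : f (bl c) ≠ f (bl c')) : saddleSign f v c = saddleSign f w c := by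
  classical
  have hr : D.curveSetoid (smoothing v) (bl c) (tr c) ↔
      D.curveSetoid (smoothing w) (bl c) (tr c) :=
    ⟨h.rel_of_apply_ne (h.symm.compat hf hc') hc' hne, h.symm.rel_of_apply_ne hf hc' hne⟩
  simp only [saddleSign, hr]

theorem saddleSign_of_apply_eq_true {f : D.Point → Bool} {c : D.Crossing} (hc : f (bl c) = true)
    (v : D.State) : saddleSign f v c = 1 := by
  simp [saddleSign, hc]

theorem Adjacent.saddleSign_cases {c : D.Crossing} {v w : D.State} (h : Adjacent c v w)
    {f : D.Point → Bool} (hc : f (bl c) = false) :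
    saddleSign f v c = -1 ∧ Nat.card (Circle w) = Nat.card (Circle v) + 1 ∨
      saddleSign f v c = 1 ∧ Nat.card (Circle v) = Nat.card (Circle w) + 1 := by
  by_cases hr : D.curveSetoid (smoothing v) (bl c) (tr c)
  · exact .inl ⟨by simp [saddleSign, hr, hc], h.symm.card_circle hr⟩
  · exact .inr ⟨by simp [saddleSign, hr], h.card_circle (h.rel_bl_tr_iff.2 hr)⟩

theorem saddleSign_comm {c c' : D.Crossing} {v₀₀ v₁₀ v₀₁ v₁₁ : D.State}
    (h₁ : Adjacent c v₀₀ v₁₀) (h₂ : Adjacent c' v₁₀ v₁₁) (h₃ : Adjacent c' v₀₀ v₀₁)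
    (h₄ : Adjacent c v₀₁ v₁₁) {f : D.Point → Bool} (hf : Compat v₀₀ f)
    (hc : f (bl c) = f (tr c)) (hc' : f (bl c') = f (tr c')) :
    saddleSign f v₁₀ c' * saddleSign f v₀₀ c = saddleSign f v₀₁ c * saddleSign f v₀₀ c' := by
  by_cases hcc : f (bl c) = f (bl c')
  · cases hb : f (bl c)
    · have hb' := hcc.symm.trans hb
      rcases h₁.saddleSign_cases hb with ⟨s₁, n₁⟩ | ⟨s₁, n₁⟩ <;>
        rcases h₂.saddleSign_cases hb' with ⟨s₂, n₂⟩ | ⟨s₂, n₂⟩ <;>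
        rcases h₃.saddleSign_cases hb' with ⟨s₃, n₃⟩ | ⟨s₃, n₃⟩ <;>
        rcases h₄.saddleSign_cases hb with ⟨s₄, n₄⟩ | ⟨s₄, n₄⟩ <;>
        rw [s₁, s₂, s₃, s₄] <;> omega
    · have hb' := hcc.symm.trans hb
      simp only [saddleSign_of_apply_eq_true hb, saddleSign_of_apply_eq_true hb']
  · rw [← h₁.saddleSign_eq_of_apply_ne hf hc (Ne.symm hcc),
      ← h₃.saddleSign_eq_of_apply_ne hf hc' hcc, mul_comm]

/-- The crossings all of whose endpoints have the same label, provided that the labeling `f` is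
constant on the circles of some state. -/
def constantCrossings (f : D.Point → Bool) : Finset D.Crossing := {c | f (bl c) = f (tr c)}

theorem mem_constantCrossings {f : D.Point → Bool} {c : D.Crossing} :
    c ∈ constantCrossings f ↔ f (bl c) = f (tr c) := by
  simp [constantCrossings]

/-- The coefficient by which the differential multiplies the value under `f` along the edge that
leaves the vertex `v` of the cube of smoothings in direction `c`. -/
noncomputable def edgeSign (f : D.Point → Bool) (v : D.State) (c : D.Crossing) : ℤ :=
  cubeSign v c * saddleSign f v c

theorem edgeSign_mul_self (f : D.Point → Bool) (v : D.State) (c : D.Crossing) :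
    edgeSign f v c * edgeSign f v c = 1 := by
  have cubeSign_sq : cubeSign v c * cubeSign v c = 1 := by simp [cubeSign, ← mul_pow]
  have saddleSign_sq : saddleSign f v c * saddleSign f v c = 1 := by
    unfold saddleSign
    split_ifs <;> rfl
  rw [edgeSign, mul_mul_mul_comm, cubeSign_sq, saddleSign_sq, mul_one]

theorem edgeSign_anticomm {f : D.Point → Bool} {v : D.State} (hf : Compat v f) {c c' : D.Crossing}
    (hfc : f (bl c) = f (tr c)) (hfc' : f (bl c') = f (tr c')) (hne : c ≠ c') (hc : v c = false)
    (hc' : v c' = false) :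
    edgeSign f (Function.update v c true) c' * edgeSign f v c =
      -(edgeSign f (Function.update v c' true) c * edgeSign f v c') := by
  have h₂ : Adjacent c' (Function.update v c true)
      (Function.update (Function.update v c true) c' true) :=
    adjacent_update (by simp [hne.symm, hc'])
  have h₄ : Adjacent c (Function.update v c' true)
      (Function.update (Function.update v c true) c' true) := by
    rw [Function.update_comm hne]
    exact adjacent_update (by simp [hne, hc])
  have hsaddle := saddleSign_comm (adjacent_update (by simp [hc])) h₂
    (adjacent_update (by simp [hc'])) h₄ hf hfc hfc'
  simp only [edgeSign, mul_mul_mul_comm _ (saddleSign f _ _)]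
  rw [cubeSign_anticomm hne hc hc', hsaddle, neg_mul]

theorem Compat.update {f : D.Point → Bool} {v : D.State} (hf : Compat v f) {c : D.Crossing}
    (hc : f (bl c) = f (tr c)) (b : Bool) : Compat (Function.update v c b) f := by
  by_cases hb : v c = b
  · rwa [Function.update_eq_self_iff.2 hb.symm]
  · exact (adjacent_update hb).symm.compat hf hc

theorem isCubeSign_edgeSign (R : Type*) [CommRing R] (f : D.Point → Bool) :
    IsCubeSign (constantCrossings f) {v | Compat v f} fun v c => (edgeSign f v c : R) where
  update_mem v hv c hc b := Compat.update hv (mem_constantCrossings.1 hc) b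
  mul_self v _ c _ _ := by exact_mod_cast congrArg (Int.cast : ℤ → R) (edgeSign_mul_self f v c)
  anticomm v hv c hc c' hc' hne h h' := by
    exact_mod_cast congrArg (Int.cast : ℤ → R) (edgeSign_anticomm hv
      (mem_constantCrossings.1 hc) (mem_constantCrossings.1 hc') hne h h')

section Evaluation

variable (F : Type*) [Field F]

open Classical in
/-- The value of the component of a cochain at the vertex `v` under the character `f`. -/
noncomputable def evalAt (v : D.State) (f : D.Point → Bool) : D.Cochain F →ₗ[F] F :=
  ∑ s : D.EnhancedState with s.1 = v, (evalState f s : F) • LinearMap.proj s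

open Classical in
theorem evalAt_apply (v : D.State) (f : D.Point → Bool) (x : D.Cochain F) :
    evalAt F v f x = ∑ s : D.EnhancedState with s.1 = v, (evalState f s : F) * x s := by
  simp [evalAt]

variable {F} in
theorem eq_zero_of_evalAt {x : D.Cochain F} (h : ∀ v f, Compat v f → evalAt F v f x = 0) :
    x = 0 := by
  classical
  funext ⟨v, y⟩
  -- The matrix of the values of the basis elements under the characters is triangular.
  induction y using WellFoundedLT.induction with
  | _ y ih =>
    have hy := h v (fun p => y ⟦p⟧) fun p q hpq => congrArg y (Quotient.sound hpq)
    rw [evalAt_apply, Finset.sum_eq_single ⟨v, y⟩] at hy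
    · simpa [evalState] using hy
    · rintro ⟨w, z⟩ hz hne
      obtain rfl : w = v := (Finset.mem_filter.1 hz).2
      rw [evalState]
      split_ifs with hle
      · have hzy : z < y := lt_of_le_of_ne (Quotient.ind fun p => Bool.le_iff_imp.2 (hle p))
          fun he => hne (he ▸ rfl)
        rw [ih z hzy, Pi.zero_apply, mul_zero]
      · rw [Int.cast_zero, zero_mul]
    · simp

theorem exists_evalAt_eq (g : D.State → (D.Point → Bool) → F) :
    ∃ x : D.Cochain F, ∀ v f, Compat v f → evalAt F v f x = g v f := by
  let Φ : D.Cochain F →ₗ[F] D.Cochain F :=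
    LinearMap.pi fun s => evalAt F s.1 fun p => s.2 (⟦p⟧ : Circle s.1)
  have hΦ : Function.Injective Φ := (injective_iff_map_eq_zero Φ).2 fun x hx =>
    eq_zero_of_evalAt fun v f hf => congrFun hx ⟨v, Quotient.lift f hf⟩
  obtain ⟨x, hx⟩ := LinearMap.injective_iff_surjective.1 hΦ
    fun s => g s.1 fun p => s.2 (⟦p⟧ : Circle s.1)
  exact ⟨x, fun v f hf => congrFun hx ⟨v, Quotient.lift f hf⟩⟩

theorem apply_and_eq_update_iff {v w : D.State} {c : D.Crossing} :
    v c = false ∧ w = Function.update v c true ↔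
      w c = true ∧ v = Function.update w c false := by
  constructor
  · rintro ⟨hc, rfl⟩
    simp [← hc]
  · rintro ⟨hc, rfl⟩
    simp [← hc]

open Classical in
theorem sum_evalState_mul_dCoeff {w : D.State} {f : D.Point → Bool} (hf : Compat w f)
    (s : D.EnhancedState) : ∑ t with t.1 = w, evalState f t * dCoeff s t =
      ∑ c ∈ constantCrossings f with w c = true,
        if s.1 = Function.update w c false then
          edgeSign f (Function.update w c false) c * evalState f s else 0 := by
  have sum_edge (c : D.Crossing) : ∑ t with t.1 = w, evalState f t *
      (if s.1 c = false ∧ t.1 = Function.update s.1 c true then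
        cubeSign s.1 c * saddleCoeff c s t else 0) =
      if f (bl c) = f (tr c) ∧ w c = true then if s.1 = Function.update w c false then
        edgeSign f (Function.update w c false) c * evalState f s else 0 else 0 := by
    rw [Finset.sum_congr rfl fun t ht => by rw [(Finset.mem_filter.1 ht).2]]
    by_cases hc : s.1 c = false ∧ w = Function.update s.1 c true
    · obtain ⟨hwc, hs⟩ := apply_and_eq_update_iff.1 hc
      have hadj : Adjacent c s.1 w := hs ▸ (adjacent_update (by simp [hwc])).symm
      simp only [if_pos hc, mul_left_comm _ (cubeSign s.1 c)]
      rw [← Finset.mul_sum, sum_evalState_mul_saddleCoeff hadj hf, ← hs]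
      simp only [hwc, and_true, if_true, edgeSign, mul_ite, mul_zero, mul_assoc]
    · simp only [hc, if_false, mul_zero, Finset.sum_const_zero, ← ite_and]
      exact (if_neg fun h => hc (apply_and_eq_update_iff.2 ⟨h.1.2, h.2⟩)).symm
  simp only [dCoeff, Finset.mul_sum]
  rw [Finset.sum_comm, constantCrossings, Finset.filter_filter, Finset.sum_filter]
  exact Finset.sum_congr rfl fun c _ => sum_edge c

theorem evalAt_d {w : D.State} {f : D.Point → Bool} (hf : Compat w f) (x : D.Cochain F) :
    evalAt F w f (d F x) = cubeDifferential (constantCrossings f) (fun v c => (edgeSign f v c : F))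
      (fun v => evalAt F v f x) w := by
  classical
  calc evalAt F w f (d F x)
      = ∑ s, ((∑ t with t.1 = w, evalState f t * dCoeff s t : ℤ) : F) * x s := by
        rw [evalAt_apply]
        simp only [d, LinearMap.coe_mk, AddHom.coe_mk, Finset.mul_sum, Int.cast_sum, Int.cast_mul,
          Finset.sum_mul, mul_assoc]
        exact Finset.sum_comm
    _ = _ := by
        simp only [sum_evalState_mul_dCoeff hf, cubeDifferential, evalAt_apply, Int.cast_sum,
          Finset.sum_mul, Finset.mul_sum, Finset.sum_filter (fun s : D.EnhancedState => s.1 = _)]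
        rw [Finset.sum_comm]
        refine Finset.sum_congr rfl fun c _ => Finset.sum_congr rfl fun s _ => ?_
        split_ifs <;> simp [mul_assoc]

theorem d_d (x : D.Cochain F) : d F (d F x) = 0 := by
  refine eq_zero_of_evalAt fun w f hf => ?_
  have hsign := isCubeSign_edgeSign F f
  rw [evalAt_d F hf, cubeDifferential, ← hsign.cubeDifferential_cubeDifferential hf
    fun v => evalAt F v f x, cubeDifferential]
  refine Finset.sum_congr rfl fun c hc => ?_
  rw [evalAt_d F (hsign.update_mem w hf c (Finset.mem_filter.1 hc).1 false)]

theorem evalAt_d_eq_zero {w : D.State} {f : D.Point → Bool} (hf : Compat w f)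
    (hne : ∀ c : D.Crossing, f (bl c) ≠ f (tr c)) (x : D.Cochain F) : evalAt F w f (d F x) = 0 := by
  have hempty : constantCrossings f = ∅ := by simp [constantCrossings, hne]
  simp [evalAt_d F hf, cubeDifferential, hempty]

theorem exists_evalAt_d_eq {x : D.Cochain F} (hx : d F x = 0) :
    ∃ y : D.Cochain F, ∀ w f, Compat w f → (∃ c : D.Crossing, f (bl c) = f (tr c)) →
      evalAt F w f (d F y) = evalAt F w f x := by
  have hcube (f : D.Point → Bool) : ∃ g : D.State → F, (∃ c : D.Crossing, f (bl c) = f (tr c)) →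
      ∀ w, Compat w f → cubeDifferential (constantCrossings f) (fun v c => (edgeSign f v c : F)) g w
        = evalAt F w f x := by
    by_cases hex : ∃ c : D.Crossing, f (bl c) = f (tr c)
    · obtain ⟨c, hc⟩ := hex
      obtain ⟨g, hg⟩ := (isCubeSign_edgeSign F f).exists_cubeDifferential_eq
        ⟨c, mem_constantCrossings.2 hc⟩ (g := fun v => evalAt F v f x) fun w hw => by
          rw [← evalAt_d F hw, hx, map_zero]
      exact ⟨g, fun _ => hg⟩
    · exact ⟨0, fun h => absurd h hex⟩
  choose g hg using hcube
  obtain ⟨y, hy⟩ := exists_evalAt_eq F fun v f => g f v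
  refine ⟨y, fun w f hf hex => ?_⟩
  rw [evalAt_d F hf, ← hg f hex w hf, cubeDifferential, cubeDifferential]
  refine Finset.sum_congr rfl fun c hc => ?_
  rw [hy _ _ (hf.update (mem_constantCrossings.1 (Finset.mem_filter.1 hc).1) false)]

end Evaluation

theorem compat_whiteOnRight (o : D.Orientation) : Compat (orientedState o) (whiteOnRight o) :=
  compat_of_arc fun _ _ => whiteOnRight_eq_of_arc o

theorem up_tr (o : D.Orientation) (c : D.Crossing) : o.up (tr c) = o.up (bl c) :=
  (up_bl_eq o c ⟨rfl, rfl⟩).symm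

theorem whiteOnRight_bl_ne_tr (o : D.Orientation) (c : D.Crossing) :
    whiteOnRight o (bl c) ≠ whiteOnRight o (tr c) := by
  rw [whiteOnRight, whiteOnRight, up_tr]
  by_cases h : Even (D.pos c.1) <;> split_ifs <;> simp [bl, tr, Nat.even_add_one, h]

/-- The direction in which a point is passed by a curve that has the region of the color `f p` to
its right, in the convention of `LinkDiagram.whiteOnRight`. -/
def direction (f : D.Point → Bool) (p : D.Point) : Bool := f p == !decide (Even (p.2 : ℕ))

theorem whiteOnRight_eq_iff {o : D.Orientation} {f : D.Point → Bool} :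
    whiteOnRight o = f ↔ o.up = direction f := by
  rw [funext_iff, funext_iff]
  refine forall_congr' fun p => ?_
  unfold whiteOnRight direction
  by_cases h : Even (p.2 : ℕ) <;> cases o.up p <;> cases f p <;> simp [h, Nat.even_add_one]

theorem orientation_ext {o o' : D.Orientation} (h : o.up = o'.up) : o = o' := by
  cases o
  cases o'
  congr

theorem whiteOnRight_injective :
    Function.Injective (whiteOnRight : D.Orientation → D.Point → Bool) := fun _ _ h =>
  orientation_ext ((whiteOnRight_eq_iff.1 h).trans (whiteOnRight_eq_iff.1 rfl).symm)

instance : Finite D.Orientation := Finite.of_injective _ whiteOnRight_injective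

noncomputable instance : Fintype D.Orientation := Fintype.ofFinite _

theorem Arc.even_iff_even_iff_ne {v : D.State} {p q : D.Point} (h : D.Arc (smoothing v) p q) :
    (Even (p.2 : ℕ) ↔ Even (q.2 : ℕ)) ↔ p.1 ≠ q.1 := by
  obtain ⟨s, s', k, hp, hq, he⟩ := h.exists_joined
  have hpar := even_otherEnd he
  have hline : p.1 = q.1 ↔ s = s' := by
    rw [← hp, ← hq, Fin.ext_iff, val_line, val_line, Nat.add_left_cancel_iff]
    cases s <;> cases s' <;> decide
  rw [Ne, hline]
  cases s <;> cases s' <;>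
    simp only [Bool.toNat_false, Bool.toNat_true, add_zero, Nat.even_add_one, not_not, reduceCtorEq,
      not_true_eq_false, not_false_eq_true, iff_true, iff_false] at hpar ⊢ <;> tauto

section ExistsOrientation

variable {v : D.State} {f : D.Point → Bool} (hf : Compat v f)
  (hne : ∀ c : D.Crossing, f (bl c) ≠ f (tr c))
include hf hne

theorem apply_bl_eq_br_iff (c : D.Crossing) :
    f (bl c) = f (br c) ↔ smoothing v c = .horizontal := by
  have eq_of_connects {p q : D.Point} (h : Connects c (smoothing v c) p q) : f p = f q :=
    hf _ _ (.rel _ _ h.arc)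
  cases hv : smoothing v c with
  | through => exact absurd hv (smoothing_ne_through v c)
  | vertical =>
    rw [hv] at eq_of_connects
    simp [eq_of_connects (.inr ⟨rfl, rfl⟩), hne c]
  | horizontal =>
    rw [hv] at eq_of_connects
    simp [eq_of_connects (.inl ⟨rfl, rfl⟩)]

theorem apply_br_ne_tl (c : D.Crossing) : f (br c) ≠ f (tl c) := by
  have eq_of_connects {p q : D.Point} (h : Connects c (smoothing v c) p q) : f p = f q :=
    hf _ _ (.rel _ _ h.arc)
  cases hv : smoothing v c with
  | through => exact absurd hv (smoothing_ne_through v c)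
  | vertical =>
    rw [hv] at eq_of_connects
    rw [← eq_of_connects (.inl ⟨rfl, rfl⟩), eq_of_connects (.inr ⟨rfl, rfl⟩)]
    exact (hne c).symm
  | horizontal =>
    rw [hv] at eq_of_connects
    rw [← eq_of_connects (.inl ⟨rfl, rfl⟩), eq_of_connects (.inr ⟨rfl, rfl⟩)]
    exact hne c

theorem direction_eq_iff {p q : D.Point} (h : D.Arc (fun _ => .through) p q) :
    direction f p = direction f q ↔ p.1 ≠ q.1 := by
  rcases h.forall_or_exists_connects with harc | ⟨c, hc⟩
  · rw [← (harc (smoothing v)).even_iff_even_iff_ne, direction, direction,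
      hf _ _ (.rel _ _ (harc _))]
    by_cases hp : Even (p.2 : ℕ) <;> by_cases hq : Even (q.2 : ℕ) <;> cases f q <;> simp [hp, hq]
  · have hfpq : f p ≠ f q := by
      rcases hc with ⟨rfl, rfl⟩ | ⟨rfl, rfl⟩
      exacts [hne c, apply_br_ne_tl hf hne c]
    have hpar : Even (q.2 : ℕ) ↔ ¬ Even (p.2 : ℕ) := by
      rcases hc with ⟨rfl, rfl⟩ | ⟨rfl, rfl⟩ <;> simp [bl, br, tr, tl, Nat.even_add_one]
    have hline : p.1 ≠ q.1 := by
      rcases hc with ⟨rfl, rfl⟩ | ⟨rfl, rfl⟩ <;> exact (Fin.castSucc_lt_succ (i := c.1)).ne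
    rw [direction, direction, Bool.eq_not_of_ne hfpq]
    by_cases hp : Even (p.2 : ℕ) <;> cases f q <;> simp [hp, hpar, hline]

theorem exists_orientation : ∃ o : D.Orientation, orientedState o = v ∧ whiteOnRight o = f := by
  refine ⟨⟨direction f, fun p q => direction_eq_iff hf hne⟩, ?_, whiteOnRight_eq_iff.2 rfl⟩
  funext c
  have hc := (apply_bl_eq_br_iff hf hne c).trans smoothing_eq_horizontal_iff
  simp only [turns_crossing, forall_const] at hc
  have hpar : decide (Even ((br c).2 : ℕ)) = !decide (Even ((bl c).2 : ℕ)) := by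
    simp only [bl, br, Nat.even_add_one, decide_not]
    congr
  have table : ∀ a b e k w : Bool, (a = b ↔ (k == w) = true) →
      (k != ((a == !e) == (b == !!e))) = w := by decide
  simp only [orientedState, direction, hpar, table _ _ _ _ _ hc]

end ExistsOrientation

open Classical in
theorem sum_filter_fst_eq {M : Type*} [AddCommMonoid M] (v : D.State) [Fintype (Circle v)]
    (g : D.EnhancedState → M) :
    ∑ s with s.1 = v, g s = ∑ y : Circle v → Bool, g ⟨v, y⟩ := by
  refine (Finset.sum_nbij (Sigma.mk v) (by simp) sigma_mk_injective.injOn ?_ fun _ _ => rfl).symm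
  rintro ⟨w, y⟩ hw
  obtain rfl : w = v := (Finset.mem_filter.1 hw).2
  exact ⟨y, Finset.mem_coe.2 (Finset.mem_univ y), rfl⟩

theorem evalState_eq_prod {v : D.State} [Fintype (Circle v)] {f : D.Point → Bool}
    (hf : Compat v f) (y : Circle v → Bool) :
    evalState f ⟨v, y⟩ = ∏ C, charValue (Quotient.lift f hf C) (y C) := by
  classical
  simp only [evalState, charValue, Finset.prod_ite_zero, Finset.prod_const_one, Finset.mem_univ,
    true_imp_iff, Quotient.forall]
  rfl

theorem sum_charValue_mul_idempotentCoeff (a w : Bool) :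
    ∑ x, charValue a x * idempotentCoeff w x = if w = a then 1 else 0 := by
  cases a <;> cases w <;> rfl

section CanonicalCocycle

variable (F : Type*) [Field F]

theorem canonicalCocycle_eq_zero {o : D.Orientation} {s : D.EnhancedState}
    (hs : s.1 ≠ orientedState o) : canonicalCocycle F o s = 0 := by
  simp [canonicalCocycle, hs]

theorem canonicalCocycle_mk {o : D.Orientation} {v : D.State} [Fintype (Circle v)]
    (hv : v = orientedState o) (y : Circle v → Bool) : canonicalCocycle F o ⟨v, y⟩ =
      ∏ C, (idempotentCoeff (circleWhiteOnRight o v hv C) (y C) : F) := by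
  rw [canonicalCocycle, dif_pos hv, finprod_eq_prod_of_fintype]

open Classical in
theorem evalAt_canonicalCocycle (o : D.Orientation) {v : D.State} {f : D.Point → Bool}
    (hf : Compat v f) : evalAt F v f (canonicalCocycle F o) =
      if v = orientedState o ∧ whiteOnRight o = f then 1 else 0 := by
  rw [evalAt_apply]
  by_cases hv : v = orientedState o
  · have : Finite (Circle v) := Quotient.finite _
    let _ : Fintype (Circle v) := Fintype.ofFinite _
    have forall_iff : (∀ C, circleWhiteOnRight o v hv C = Quotient.lift f hf C) ↔
        whiteOnRight o = f := Quotient.forall.trans funext_iff.symm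
    calc ∑ s with s.1 = v, (evalState f s : F) * canonicalCocycle F o s
        = ∑ y : Circle v → Bool, ∏ C, ((charValue (Quotient.lift f hf C) (y C) *
            idempotentCoeff (circleWhiteOnRight o v hv C) (y C) : ℤ) : F) := by
          simp only [sum_filter_fst_eq, evalState_eq_prod hf, canonicalCocycle_mk F hv,
            Int.cast_prod, Int.cast_mul, Finset.prod_mul_distrib]
      _ = ∏ C, ((∑ x, charValue (Quotient.lift f hf C) x *
            idempotentCoeff (circleWhiteOnRight o v hv C) x : ℤ) : F) := by
          simp only [Int.cast_sum, Finset.prod_univ_sum, Fintype.piFinset_univ]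
      _ = if v = orientedState o ∧ whiteOnRight o = f then 1 else 0 := by
          simp only [sum_charValue_mul_idempotentCoeff, Int.cast_ite, Int.cast_one, Int.cast_zero,
            Finset.prod_ite_zero, Finset.prod_const_one, Finset.mem_univ, true_imp_iff, forall_iff,
            hv, true_and]
  · rw [if_neg fun h => hv h.1]
    refine Finset.sum_eq_zero fun s hs => ?_
    rw [canonicalCocycle_eq_zero F ((Finset.mem_filter.1 hs).2 ▸ hv), mul_zero]

theorem evalAt_canonicalCocycle_eq_zero (o : D.Orientation) {v : D.State} {f : D.Point → Bool}
    (hf : Compat v f) {c : D.Crossing} (hc : f (bl c) = f (tr c)) :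
    evalAt F v f (canonicalCocycle F o) = 0 := by
  classical
  rw [evalAt_canonicalCocycle F o hf, if_neg]
  rintro ⟨-, rfl⟩
  exact whiteOnRight_bl_ne_tr o c hc

theorem d_canonicalCocycle (o : D.Orientation) : d F (canonicalCocycle F o) = 0 := by
  refine eq_zero_of_evalAt fun w f hf => ?_
  rw [evalAt_d F hf]
  refine Finset.sum_eq_zero fun c hc => ?_
  have hfc := mem_constantCrossings.1 (Finset.mem_filter.1 hc).1
  exact mul_eq_zero_of_right _ (evalAt_canonicalCocycle_eq_zero F o (hf.update hfc false) hfc)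

theorem canonicalCocycle_ne_d (o : D.Orientation) (y : D.Cochain F) :
    canonicalCocycle F o ≠ d F y := by
  intro h
  have heval := evalAt_canonicalCocycle F o (compat_whiteOnRight o)
  rw [h, evalAt_d_eq_zero F (compat_whiteOnRight o) (whiteOnRight_bl_ne_tr o)] at heval
  simp at heval

theorem exists_eq_d_add_sum_canonicalCocycle {x : D.Cochain F} (hx : d F x = 0) :
    ∃ (y : D.Cochain F) (a : D.Orientation → F),
      x = d F y + ∑ o, a o • canonicalCocycle F o := by
  classical
  obtain ⟨y, hy⟩ := exists_evalAt_d_eq F hx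
  refine ⟨y, fun o => evalAt F (orientedState o) (whiteOnRight o) x, sub_eq_zero.1 ?_⟩
  refine eq_zero_of_evalAt fun w f hf => ?_
  simp only [map_sub, map_add, map_sum, map_smul, smul_eq_mul]
  by_cases hex : ∃ c : D.Crossing, f (bl c) = f (tr c)
  · obtain ⟨c, hc⟩ := hex
    simp only [hy w f hf ⟨c, hc⟩, evalAt_canonicalCocycle_eq_zero F _ hf hc, mul_zero,
      Finset.sum_const_zero, add_zero, sub_self]
  · push Not at hex
    obtain ⟨o, rfl, rfl⟩ := exists_orientation hf hex
    rw [evalAt_d_eq_zero F hf hex, Finset.sum_eq_single o]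
    · simp [evalAt_canonicalCocycle F o hf]
    · intro o' _ hne
      rw [evalAt_canonicalCocycle F o' hf, if_neg fun h => hne (whiteOnRight_injective h.2),
        mul_zero]
    · simp

end CanonicalCocycle

theorem weight_orientedState (o : D.Orientation) : weight (orientedState o) = nMinus o := by
  unfold weight nMinus orientedState IsPositive
  congr
  ext c
  simp

theorem nPlus_add_nMinus (o : D.Orientation) : nPlus o + nMinus o = Fintype.card D.Crossing := by
  simpa [nPlus, nMinus] using Finset.card_filter_add_card_filter_not
    (s := (Finset.univ : Finset D.Crossing)) (fun c => IsPositive o c = true)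

theorem nPlus_eq {o o' : D.Orientation} (h : nMinus o' = nMinus o) : nPlus o' = nPlus o := by
  have := nPlus_add_nMinus o
  have := nPlus_add_nMinus o'
  lia

theorem qDegree_eq {o o' : D.Orientation} (h : nMinus o' = nMinus o) (s : D.EnhancedState) :
    qDegree o' s = qDegree o s := by
  rw [qDegree, qDegree, h, nPlus_eq h]

theorem beq_up_eq_of_rel (o o' : D.Orientation) {p q : D.Point}
    (h : D.curveSetoid (fun _ => .through) p q) :
    (o.up p == o'.up p) = (o.up q == o'.up q) := by
  induction h with
  | rel p q h =>
    have hiff := (o.compat p q h).trans (o'.compat p q h).symm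
    revert hiff
    cases o.up p <;> cases o.up q <;> cases o'.up p <;> cases o'.up q <;> decide
  | refl => rfl
  | symm _ _ _ ih => exact ih.symm
  | trans _ _ _ _ _ ih₁ ih₂ => exact ih₁.trans ih₂

theorem isPositive_eq_of_component_eq (o o' : D.Orientation) {c : D.Crossing}
    (h : (⟦bl c⟧ : D.Component) = ⟦br c⟧) : IsPositive o c = IsPositive o' c := by
  have hup := beq_up_eq_of_rel o o' (Quotient.exact h)
  rw [IsPositive, IsPositive]
  revert hup
  cases o.up (bl c) <;> cases o.up (br c) <;> cases o'.up (bl c) <;> cases o'.up (br c) <;> simp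

theorem sum_sign (o : D.Orientation) :
    ∑ c : D.Crossing, (if IsPositive o c = true then 1 else -1 : ℚ) = nPlus o - nMinus o := by
  simp [Finset.sum_ite, nPlus, nMinus, sub_eq_add_neg]

open Classical in
theorem totalLinkingNumber_eq_writhe_sub (o : D.Orientation) :
    totalLinkingNumber o = ((nPlus o - nMinus o : ℚ) -
      ∑ c : D.Crossing with (⟦bl c⟧ : D.Component) = ⟦br c⟧,
        if IsPositive o c = true then 1 else -1) / 2 := by
  rw [totalLinkingNumber, ← sum_sign, Finset.sum_filter, ← Finset.sum_sub_distrib]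
  congr! 2 with c
  split_ifs <;> simp

theorem totalLinkingNumber_eq {o o' : D.Orientation} (h : nMinus o' = nMinus o) :
    totalLinkingNumber o' = totalLinkingNumber o := by
  classical
  rw [totalLinkingNumber_eq_writhe_sub, totalLinkingNumber_eq_writhe_sub, h, nPlus_eq h]
  congr 2
  refine Finset.sum_congr rfl fun c hc => ?_
  rw [isPositive_eq_of_component_eq o' o (Finset.mem_filter.1 hc).2]

theorem weight_update {v : D.State} {c : D.Crossing} (hc : v c = false) :
    weight (Function.update v c true) = weight v + 1 := by
  classical
  rw [weight, weight, ← Finset.card_insert_of_notMem (a := c) (by simp [hc])]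
  congr 1
  ext b
  by_cases hb : b = c <;> simp [Function.update_apply, hb]

theorem homDegree_of_dCoeff_ne_zero (o : D.Orientation) {s t : D.EnhancedState}
    (h : dCoeff s t ≠ 0) : homDegree o t = homDegree o s + 1 := by
  classical
  obtain ⟨c, -, hc⟩ := Finset.exists_ne_zero_of_sum_ne_zero h
  obtain ⟨hsc, htc⟩ := (ite_ne_right_iff.1 hc).1
  rw [homDegree, homDegree, htc, weight_update hsc]
  push_cast
  ring

theorem exists_qDegree_bounds (o : D.Orientation) :
    ∃ a b : ℤ, ∀ s : D.EnhancedState, a ≤ qDegree o s ∧ qDegree o s < b := by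
  obtain ⟨a, ha⟩ := (Set.finite_range (qDegree o)).bddBelow
  obtain ⟨b, hb⟩ := (Set.finite_range (qDegree o)).bddAbove
  exact ⟨a, b + 1, fun s => ⟨ha ⟨s, rfl⟩, Int.lt_add_one_of_le (hb ⟨s, rfl⟩)⟩⟩

section Filtration

variable (F : Type*) [Field F]

theorem filtration_eq {o o' : D.Orientation} (h : nMinus o' = nMinus o) :
    filtration F o' = filtration F o :=
  funext fun _ => Submodule.ext fun _ => forall₂_congr fun s _ => by rw [qDegree_eq h]

theorem filtration_antitone (o : D.Orientation) : Antitone (filtration F o) :=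
  fun _ _ h _ hx s hs => h.trans (hx s hs)

theorem filtration_eq_top {o : D.Orientation} {j : ℤ} (h : ∀ s, j ≤ qDegree o s) :
    filtration F o j = ⊤ :=
  eq_top_iff.2 fun _ _ s _ => h s

theorem filtration_eq_bot {o : D.Orientation} {j : ℤ} (h : ∀ s, qDegree o s < j) :
    filtration F o j = ⊥ :=
  eq_bot_iff.2 fun x hx => (Submodule.mem_bot F).2 <| funext fun s => by
    by_contra hs
    exact (h s).not_ge (hx s hs)

theorem mk_mem_homologyFiltration_iff {x : D.Cochain F} (hx : d F x = 0) (o : D.Orientation)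
    (j : ℤ) : Submodule.Quotient.mk x ∈ homologyFiltration F o j ↔
      ∃ y, x - d F y ∈ filtration F o j := by
  constructor
  · rintro ⟨z, ⟨-, hz⟩, hzx⟩
    obtain ⟨y, hy⟩ := (Submodule.Quotient.eq _).1 hzx.symm
    exact ⟨y, by rwa [hy, sub_sub_cancel]⟩
  · rintro ⟨y, hy⟩
    refine ⟨x - d F y, ⟨?_, hy⟩, (Submodule.Quotient.eq _).2 ⟨-y, ?_⟩⟩
    · rw [SetLike.mem_coe, LinearMap.mem_ker, map_sub, hx, d_d, sub_zero]
    · rw [map_neg, sub_sub_cancel_left]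

/-- The canonical class of `o` lies in the `j`-th step of the filtration of homology. -/
def CanonicalIn (o : D.Orientation) (j : ℤ) : Prop :=
  ∃ y : D.Cochain F, canonicalCocycle F o - d F y ∈ filtration F o j

variable {F} in
theorem CanonicalIn.mono {o : D.Orientation} {j j' : ℤ} (h : CanonicalIn F o j') (hj : j ≤ j') :
    CanonicalIn F o j :=
  h.imp fun _ hy => filtration_antitone F o hj hy

theorem isSInvariant_iff {o : D.Orientation} {t : ℤ} : IsSInvariant F o t ↔
    IsGreatest {j : ℤ | j ≡ D.numComponents [ZMOD 2] ∧ CanonicalIn F o j} (t - 1) := by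
  simp only [IsSInvariant, mk_mem_homologyFiltration_iff F (d_canonicalCocycle F o), CanonicalIn]

theorem exists_isSInvariant (o : D.Orientation) : ∃ t, IsSInvariant F o t := by
  obtain ⟨a, b, hab⟩ := exists_qDegree_bounds o
  let n : ℤ := D.numComponents
  have bounded (j : ℤ) (hj : j ≡ n [ZMOD 2] ∧ CanonicalIn F o j) : j ≤ b := by
    obtain ⟨-, y, hy⟩ := hj
    by_contra hlt
    rw [filtration_eq_bot F fun s => (hab s).2.trans (not_le.1 hlt), Submodule.mem_bot,
      sub_eq_zero] at hy
    exact canonicalCocycle_ne_d F o y hy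
  have inhabited : n - 2 * (|n| + |a|) ≡ n [ZMOD 2] ∧ CanonicalIn F o (n - 2 * (|n| + |a|)) := by
    refine ⟨Int.modEq_iff_dvd.2 ⟨|n| + |a|, by ring⟩, 0, ?_⟩
    rw [filtration_eq_top F fun s => ?_]
    · trivial
    · linarith [neg_abs_le a, le_abs_self n, abs_nonneg n, abs_nonneg a, (hab s).1]
  obtain ⟨m, hm, hmax⟩ := Int.exists_greatest_of_bdd ⟨b, bounded⟩ ⟨_, inhabited⟩
  refine ⟨m + 1, (isSInvariant_iff F).2 ?_⟩
  rw [add_sub_cancel_right]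
  exact ⟨hm, hmax⟩

end Filtration

section BaseChange

variable {K F : Type*} [Field K] [Field F]

theorem map_intCast_mul (ρ : F →+ K) (n : ℤ) (a : F) : ρ (n * a) = n * ρ a := by
  rw [← zsmul_eq_mul, map_zsmul, zsmul_eq_mul]

theorem d_comp (ρ : F →+ K) (x : D.Cochain F) : d K (ρ ∘ x) = ρ ∘ d F x := by
  funext t
  simp [d, map_intCast_mul]

theorem comp_canonicalCocycle (ρ : F →+ K) (hρ : ρ 1 = 1) (o : D.Orientation) :
    ρ ∘ canonicalCocycle F o = canonicalCocycle K o := by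
  have map_intCast (n : ℤ) : ρ n = n := by simpa [hρ] using map_intCast_mul ρ n 1
  funext s
  have : Finite (Circle s.1) := Quotient.finite _
  let _ : Fintype (Circle s.1) := Fintype.ofFinite _
  by_cases h : s.1 = orientedState o
  · simp only [Function.comp_apply, canonicalCocycle, dif_pos h, finprod_eq_prod_of_fintype,
      ← Int.cast_prod, map_intCast]
  · simp only [Function.comp_apply, canonicalCocycle_eq_zero _ h, map_zero]

theorem CanonicalIn.map {o : D.Orientation} {j : ℤ} (h : CanonicalIn F o j) (ρ : F →+ K)
    (hρ : ρ 1 = 1) : CanonicalIn K o j := by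
  obtain ⟨y, hy⟩ := h
  refine ⟨ρ ∘ y, fun s hs => hy s fun h0 => hs ?_⟩
  rw [← comp_canonicalCocycle ρ hρ, d_comp]
  simpa using congrArg ρ h0

theorem canonicalIn_iff_of_ringHom (ρ : K →+* F) (o : D.Orientation) (j : ℤ) :
    CanonicalIn F o j ↔ CanonicalIn K o j := by
  refine ⟨fun h => ?_, fun h => h.map ρ.toAddMonoidHom (map_one ρ)⟩
  let _ : Algebra K F := ρ.toAlgebra
  -- A `K`-linear retraction of `F` onto `K` maps a correcting coboundary over `F` to one over `K`.
  obtain ⟨π, hπ⟩ := LinearMap.exists_leftInverse_of_injective (Algebra.linearMap K F)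
    (LinearMap.ker_eq_bot.2 (algebraMap K F).injective)
  exact h.map π.toAddMonoidHom (by simpa using LinearMap.congr_fun hπ 1)

theorem isSInvariant_iff_of_ringHom (ρ : K →+* F) (o : D.Orientation) (t : ℤ) :
    IsSInvariant F o t ↔ IsSInvariant K o t := by
  simp only [isSInvariant_iff, canonicalIn_iff_of_ringHom ρ]

end BaseChange

section SpectralSequence

variable (F : Type*) [Field F]

/-- The projection of the cochains to those of homological degree `i`. -/
def homProj (o : D.Orientation) (i : ℤ) : D.Cochain F →ₗ[F] D.Cochain F :=
  LinearMap.pi fun s => if homDegree o s = i then LinearMap.proj s else 0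

theorem homProj_apply (o : D.Orientation) (i : ℤ) (x : D.Cochain F) (s : D.EnhancedState) :
    homProj F o i x s = if homDegree o s = i then x s else 0 := by
  rw [homProj, LinearMap.pi_apply]
  split_ifs <;> rfl

theorem d_homProj (o : D.Orientation) (i : ℤ) (x : D.Cochain F) :
    d F (homProj F o (i - 1) x) = homProj F o i (d F x) := by
  funext t
  have degree_iff {s : D.EnhancedState} (hs : dCoeff s t ≠ 0) :
      homDegree o s = i - 1 ↔ homDegree o t = i := by
    rw [homDegree_of_dCoeff_ne_zero o hs, eq_sub_iff_add_eq]
  simp only [homProj_apply, d, LinearMap.coe_mk, AddHom.coe_mk]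
  calc ∑ s, (dCoeff s t : F) * (if homDegree o s = i - 1 then x s else 0)
      = ∑ s, if homDegree o t = i then (dCoeff s t : F) * x s else 0 := by
        refine Finset.sum_congr rfl fun s _ => ?_
        by_cases hs : dCoeff s t = 0
        · simp [hs]
        · simp only [degree_iff hs, mul_ite, mul_zero]
    _ = if homDegree o t = i then ∑ s, (dCoeff s t : F) * x s else 0 := by
        split_ifs <;> simp

theorem d_homProj_eq_zero (o : D.Orientation) (i : ℤ) {x : D.Cochain F} (hx : d F x = 0) :
    d F (homProj F o i x) = 0 := by
  simpa [hx] using d_homProj F o (i + 1) x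

theorem homProj_mem_homPart (o : D.Orientation) (i : ℤ) (x : D.Cochain F) :
    homProj F o i x ∈ homPart F o i := fun s hs => by
  rw [homProj_apply] at hs
  exact (ite_ne_right_iff.1 hs).1

theorem homProj_mem_filtration {o : D.Orientation} (i : ℤ) {j : ℤ} {x : D.Cochain F}
    (hx : x ∈ filtration F o j) : homProj F o i x ∈ filtration F o j := fun s hs =>
  hx s fun h => hs (by rw [homProj_apply, h, ite_self])

theorem homProj_of_mem_homPart {o : D.Orientation} {i : ℤ} {x : D.Cochain F}
    (hx : x ∈ homPart F o i) (i' : ℤ) : homProj F o i' x = if i = i' then x else 0 := by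
  funext s
  rw [homProj_apply]
  by_cases hs : x s = 0
  · split_ifs <;> simp [hs]
  · rw [hx s hs]
    split_ifs <;> rfl

theorem canonicalCocycle_mem_homPart (o o' : D.Orientation) :
    canonicalCocycle F o' ∈ homPart F o (nMinus o' - nMinus o) := by
  intro s hs
  rw [homDegree, not_imp_comm.1 (canonicalCocycle_eq_zero F) hs, weight_orientedState]

/-- The cocycles of homological degree `i` in the `j`-th step of the filtration. -/
noncomputable def filteredCocycles (o : D.Orientation) (i j : ℤ) : Submodule F (D.Cochain F) :=
  homPart F o i ⊓ filtration F o j ⊓ LinearMap.ker (d F)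

/-- The coboundaries of homological degree `i`. -/
noncomputable def coboundaries (o : D.Orientation) (i : ℤ) : Submodule F (D.Cochain F) :=
  (homPart F o (i - 1)).map (d F)

theorem filteredCocycles_antitone (o : D.Orientation) (i : ℤ) :
    Antitone (filteredCocycles F o i) :=
  fun _ _ h => inf_le_inf_right _ (inf_le_inf_left _ (filtration_antitone F o h))

theorem mem_filteredCocycles_sup_coboundaries_iff {o : D.Orientation} {i : ℤ} {x : D.Cochain F}
    (hi : x ∈ homPart F o i) (hx : d F x = 0) (j : ℤ) :
    x ∈ filteredCocycles F o i j ⊔ coboundaries F o i ↔ ∃ y, x - d F y ∈ filtration F o j := by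
  constructor
  · intro hmem
    obtain ⟨z, hz, _, ⟨y, -, rfl⟩, rfl⟩ := Submodule.mem_sup.1 hmem
    exact ⟨y, by simpa using hz.1.2⟩
  · rintro ⟨y, hy⟩
    have hproj : homProj F o i (x - d F y) + d F (homProj F o (i - 1) y) = x := by
      rw [d_homProj, ← map_add, sub_add_cancel, homProj_of_mem_homPart F hi, if_pos rfl]
    rw [← hproj]
    refine Submodule.add_mem_sup ⟨⟨homProj_mem_homPart F o i _, homProj_mem_filtration F i hy⟩, ?_⟩
      ⟨_, homProj_mem_homPart F o _ y, rfl⟩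
    exact d_homProj_eq_zero F o i (by rw [map_sub, hx, d_d, sub_zero])

theorem canonicalCocycle_mem_iff {o o' : D.Orientation} (h : nMinus o' = nMinus o) (j : ℤ) :
    canonicalCocycle F o' ∈ filteredCocycles F o 0 j ⊔ coboundaries F o 0 ↔
      CanonicalIn F o' j := by
  have hdeg := canonicalCocycle_mem_homPart F o o'
  rw [h, sub_self] at hdeg
  rw [mem_filteredCocycles_sup_coboundaries_iff F hdeg (d_canonicalCocycle F o'), CanonicalIn,
    filtration_eq F h]

theorem filteredCocycles_le_of_canonicalIn {o : D.Orientation} {j : ℤ}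
    (h : ∀ o' : D.Orientation, nMinus o' = nMinus o → CanonicalIn F o' j) (k : ℤ) :
    filteredCocycles F o 0 k ≤ filteredCocycles F o 0 j ⊔ coboundaries F o 0 := by
  rintro z ⟨⟨hz, -⟩, hdz⟩
  obtain ⟨y, a, hya⟩ := exists_eq_d_add_sum_canonicalCocycle F (LinearMap.mem_ker.1 hdz)
  have hproj : z = d F (homProj F o (0 - 1) y) +
      ∑ o', a o' • homProj F o 0 (canonicalCocycle F o') := by
    simp only [d_homProj, ← map_smul, ← map_sum, ← map_add, ← hya]
    rw [homProj_of_mem_homPart F hz, if_pos rfl]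
  rw [hproj]
  refine Submodule.add_mem _ (Submodule.mem_sup_right ⟨_, homProj_mem_homPart F o _ y, rfl⟩)
    (Submodule.sum_mem _ fun o' _ => Submodule.smul_mem _ _ ?_)
  rw [homProj_of_mem_homPart F (canonicalCocycle_mem_homPart F o o')]
  split_ifs with h0
  · have ho' : nMinus o' = nMinus o := Int.ofNat_inj.1 (sub_eq_zero.1 h0)
    exact (canonicalCocycle_mem_iff F ho' j).2 (h o' ho')
  · exact Submodule.zero_mem _

theorem pageCycles_eq_filteredCocycles {o : D.Orientation} {r j : ℤ}
    (h : ∀ s, qDegree o s < j + 2 * r) (i : ℤ) :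
    pageCycles F o r i j = filteredCocycles F o i j := by
  rw [pageCycles, filteredCocycles, filtration_eq_bot F h]
  rfl

theorem nontrivial_page_iff {o : D.Orientation} {r j : ℤ}
    (hlow : ∀ s, j - 2 * (r - 1) ≤ qDegree o s) (hhigh : ∀ s, qDegree o s < j + 2 * r) (i : ℤ) :
    Nontrivial (Page F o r i j) ↔
      ¬ filteredCocycles F o i j ≤ filteredCocycles F o i (j + 2) ⊔ coboundaries F o i := by
  have hhigh' (s) : qDegree o s < j + 2 + 2 * (r - 1) := by linarith [hhigh s]
  rw [Submodule.Quotient.nontrivial_iff, Ne, Submodule.comap_subtype_eq_top, pageBoundaries,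
    pageCycles_eq_filteredCocycles F hhigh, pageCycles_eq_filteredCocycles F hhigh', not_iff_not,
    pageCycles, filtration_eq_top F hlow, inf_top_eq, sub_add_cancel]
  refine ⟨fun h => h.trans (sup_le_sup_left (Submodule.map_mono inf_le_left) _), fun h z hz => ?_⟩
  obtain ⟨z', hz', _, ⟨y, hy, rfl⟩, rfl⟩ := Submodule.mem_sup.1 (h hz)
  have hdy := Submodule.sub_mem _ hz.1.2 (filtration_antitone F o (by lia : j ≤ j + 2) hz'.1.2)
  rw [add_sub_cancel_left] at hdy
  exact Submodule.add_mem_sup hz' ⟨y, ⟨hy, hdy⟩, rfl⟩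

theorem eInftyNeZero_iff (o : D.Orientation) (i j : ℤ) : EInftyNeZero F o i j ↔
    ¬ filteredCocycles F o i j ≤ filteredCocycles F o i (j + 2) ⊔ coboundaries F o i := by
  obtain ⟨a, b, hab⟩ := exists_qDegree_bounds o
  rw [EInftyNeZero, ← Filter.eventually_const (f := Filter.atTop (α := ℤ)) (p := ¬ _)]
  refine Filter.eventually_congr ?_
  filter_upwards [Filter.eventually_ge_atTop 0, Filter.eventually_ge_atTop (b - j),
    Filter.eventually_ge_atTop (j - a + 2)] with r _ _ _
  have hlow (s) : j - 2 * (r - 1) ≤ qDegree o s := by linarith [(hab s).1]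
  have hhigh (s) : qDegree o s < j + 2 * r := by linarith [(hab s).2]
  exact nontrivial_page_iff F hlow hhigh i

theorem isSMin_of_isSInvariant {s : D.Orientation → ℤ} (hs : ∀ o, IsSInvariant F o (s o))
    {o o' : D.Orientation} (ho' : nMinus o' = nMinus o)
    (hmin : ∀ o'', nMinus o'' = nMinus o → s o' ≤ s o'') : IsSMin F o (s o') := by
  have isGreatest (o) := (isSInvariant_iff F).1 (hs o)
  have canonicalIn (o'') (ho'' : nMinus o'' = nMinus o) : CanonicalIn F o'' (s o' - 1) :=
    (isGreatest o'').1.2.mono (by linarith [hmin o'' ho''])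
  refine ⟨⟨(isGreatest o').1.1, ?_⟩, ?_⟩
  · rw [eInftyNeZero_iff]
    intro hle
    have hnext : CanonicalIn F o' (s o' - 1 + 2) := (canonicalCocycle_mem_iff F ho' _).1 <|
      sup_le hle le_sup_right ((canonicalCocycle_mem_iff F ho' _).2 (canonicalIn o' ho'))
    have hparity : s o' - 1 + 2 ≡ D.numComponents [ZMOD 2] :=
      Int.ModEq.trans (by simp [Int.ModEq]) (isGreatest o').1.1
    linarith [(isGreatest o').2 ⟨hparity, hnext⟩]
  · rintro j ⟨hj, hE⟩
    by_contra hlt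
    have hstep : j + 2 ≤ s o' - 1 := by
      have hparity := hj.trans (isGreatest o').1.1.symm
      unfold Int.ModEq at hparity
      lia
    refine (eInftyNeZero_iff F o 0 j).1 hE ?_
    exact (filteredCocycles_le_of_canonicalIn F canonicalIn j).trans
      (sup_le_sup_right (filteredCocycles_antitone F o 0 hstep) _)

end SpectralSequence

end LinkDiagram

theorem exists_primeField (p : ℕ) (hp : p.Prime ∨ p = 0) :
    ∃ (K : Type) (_ : Field K), ∀ (F : Type*) [Field F] [CharP F p], Nonempty (K →+* F) := by
  rcases hp with hp | rfl
  · have : Fact p.Prime := ⟨hp⟩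
    exact ⟨ZMod p, inferInstance, fun F _ _ => ⟨ZMod.castHom dvd_rfl F⟩⟩
  · refine ⟨ℚ, inferInstance, fun F _ _ => ?_⟩
    have : CharZero F := CharP.charP_to_charZero F
    exact ⟨Rat.castHom F⟩

theorem proposition1p1 (D : LinkDiagram) (o : D.Orientation) (p : ℕ) (hp : p.Prime ∨ p = 0) :
    ∃ o' : D.Orientation,
      (∃ t : ℤ, ∀ (F : Type*) [Field F] [CharP F p],
        LinkDiagram.IsSInvariant F o' t ∧ LinkDiagram.IsSMin F o t) ∧
      LinkDiagram.totalLinkingNumber o' = LinkDiagram.totalLinkingNumber o := by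
  obtain ⟨K, _, hK⟩ := exists_primeField p hp
  choose s hs using LinkDiagram.exists_isSInvariant K (D := D)
  obtain ⟨o', ho', hmin⟩ := Set.exists_min_image
    {o' : D.Orientation | LinkDiagram.nMinus o' = LinkDiagram.nMinus o} s (Set.toFinite _) ⟨o, rfl⟩
  refine ⟨o', ⟨s o', fun F _ _ => ?_⟩, LinkDiagram.totalLinkingNumber_eq ho'⟩
  obtain ⟨ρ⟩ := hK F
  have hsF (o) : LinkDiagram.IsSInvariant F o (s o) :=
    (LinkDiagram.isSInvariant_iff_of_ringHom ρ o (s o)).2 (hs o)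
  exact ⟨hsF o', LinkDiagram.isSMin_of_isSInvariant F hsF ho' hmin⟩
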